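/- Let $D=\operatorname{diag}\{d_1,\dots,d_m\}$ with $d_1>d_2>\cdots>d_m>0$, let $\widehat D$ be a diagonal $m\times m$ matrix with positive diagonal entries, let $0<a\le\infty$ and $\mathcal D=\{(x,t): 0\le x<\infty,\ 0\le t<a\}$. Write $[A,B]=AB-BA$ and $\|\cdot\|$ for the operator norm induced by the $l^2$ vector norm. Let $\varrho:\mathcal D\to\mathbb C^{m\times m}$ be uniformly bounded and continuously differentiable on $\mathcal D$ (one-sided derivatives at the boundary) and satisfy on $\mathcal D$ the $N$-wave (nonlinear optics) equation $$[D,\varrho_t]-[\widehat D,\varrho_x]=[D,\varrho][\widehat D,\varrho]-[\widehat D,\varrho][D,\varrho],\qquad \varrho=\varrho^*,$$ with the boundary condition $\varrho(0,t)=\widehat\rho(t)$ for $0\le t<a$. For $z\in\mathbb C$ let $R(t,z)$ be the solution on $[0,a)$ of $$R_t(t,z)=\big(\mathrm i z\widehat D-[\widehat D,\widehat\rho(t)]\big)R(t,z),\qquad R(0,z)=I_m .$$ Put $\zeta(x,t)=[D,\varrho(x,t)]$, let $M_0$ be a number such that $\|\zeta(x,t)\|\le M_0$ on $\mathcal D$,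 and let $M>0$ satisfy $M>\max_{1\le k<m}2M_0/(d_k-d_{k+1})$. For fixed $t$, let $w(x,t,z)$ be the fundamental solution of $w_x=(\mathrm i zD-\zeta(x,t))w$, $x\ge0$, $w(0,t,z)=I_m$. A Weyl function of this system on a half-plane $\{\operatorname{Im} z<-M'\}$, $M'>0$, is an analytic $m\times m$ matrix function $\varphi(z)$ on this half-plane such that for some $r>0$ and all $z$ with $\operatorname{Im} z<-M'$ $$\int_0^\infty \exp\{\mathrm i\overline z xD\}\varphi(z)^*w(x,t,z)^*w(x,t,z)\varphi(z)\exp\{-(\mathrm i zD+rI_m)x\}\,dx<\infty ,$$ and such that $\varphi_{ii}(z)\equiv1$ and $\varphi_{ij}(z)\equiv0$ for $i>j$ (normalization conditions). Then for each $t\in[0,a)$ the system has a Weyl function $\varphi(t,z)$ on $\{\operatorname{Im} z<-M\}$; it is unique, in the sense that every Weyl function of the system on a half-plane $\{\operatorname{Im} z<-M'\}$, $M'>0$, coincides with $\varphi(t,\cdot)$ where both are defined. For all $1\le k<m$, $t\in[0,a)$ and $\operatorname{Im} z<-M$ the matrix $\begin{bmatrix}0&I_{m-k}\end{bmatrix}R(t,z)\varphi(0,z)\begin{bmatrix}0\\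 I_{m-k}\end{bmatrix}$ is invertible, so that $$\breve\psi_k(t,z):=\begin{bmatrix}I_k&0\end{bmatrix}R(t,z)\varphi(0,z)\begin{bmatrix}0\\ I_{m-k}\end{bmatrix}\left(\begin{bmatrix}0&I_{m-k}\end{bmatrix}R(t,z)\varphi(0,z)\begin{bmatrix}0\\ I_{m-k}\end{bmatrix}\right)^{-1}$$ is well defined, and the evolution of the Weyl function is given by $$\{\varphi_{i,k+1}(t,z)\}_{i=1}^k=\breve\psi_k(t,z)\begin{bmatrix}1\\0\\ \vdots\\0\end{bmatrix},\qquad \operatorname{Im} z<-M,\quad 1\le k<m,$$ together with the normalization conditions $\varphi_{ii}(t,z)\equiv1$ and $\varphi_{ij}(t,z)\equiv0$ for $i>j$. -/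

import Mathlib

open scoped Matrix Matrix.Norms.L2Operator

noncomputable section

namespace NWave

/-- The time interval `[0, a)`, where `a` may be `⊤`. -/
def timeInterval (a : EReal) : Set ℝ := {t | 0 ≤ t ∧ (t : EReal) < a}

/-- The semi-strip of all pairs `(x, t)` with `0 ≤ x < ∞` and `0 ≤ t < a`. -/
def semiStrip (a : EReal) : Set (ℝ × ℝ) := Set.Ici 0 ×ˢ timeInterval a

/-- The open half-plane `Im z < -M`. -/
def lowerHalfPlane (M : ℝ) : Set ℂ := {z | z.im < -M}

/-- The complex diagonal matrix with the given real diagonal. -/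
def diagMat {m : ℕ} (d : Fin m → ℝ) : Matrix (Fin m) (Fin m) ℂ :=
  Matrix.diagonal fun i => (d i : ℂ)

/-- `ϱ` is a solution of the nonlinear optics (`N`-wave) equation on the semi-strip:
`[D, ϱ_t] - [D̂, ϱ_x] = [D, ϱ][D̂, ϱ] - [D̂, ϱ][D, ϱ]` and `ϱ = ϱ*`,
with one-sided partial derivatives at the boundary. -/
def IsNWaveSolution {m : ℕ} (d dhat : Fin m → ℝ) (a : EReal)
    (ϱ : ℝ → ℝ → Matrix (Fin m) (Fin m) ℂ) : Prop :=
  ∀ x t : ℝ, 0 ≤ x → t ∈ timeInterval a →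
    (ϱ x t).IsHermitian ∧
    ⁅diagMat d, derivWithin (fun s => ϱ x s) (timeInterval a) t⁆
        - ⁅diagMat dhat, derivWithin (fun y => ϱ y t) (Set.Ici 0) x⁆
      = ⁅diagMat d, ϱ x t⁆ * ⁅diagMat dhat, ϱ x t⁆
        - ⁅diagMat dhat, ϱ x t⁆ * ⁅diagMat d, ϱ x t⁆

/-- `w` solves `w_x = (i z D - ζ(x)) w` on the set `s` (an interval that starts at `0`),
and `w(0) = I`. -/
def IsFundamentalSolution {m : ℕ} (d : Fin m → ℝ) (ζ : ℝ → Matrix (Fin m) (Fin m) ℂ)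
    (s : Set ℝ) (z : ℂ) (w : ℝ → Matrix (Fin m) (Fin m) ℂ) : Prop :=
  w 0 = 1 ∧
    ∀ x ∈ s, HasDerivWithinAt w (((Complex.I * z) • diagMat d - ζ x) * w x) s x

/-- `φ` is a Weyl function, on the half-plane `Im z < -M`, of the system
`w_x = (i z D - ζ(x)) w` on `[0, ∞)` with continuous bounded `ζ`: it is analytic there,
the integral over `(0, ∞)` of
`exp(i z̄ x D) φ(z)* w(x,z)* w(x,z) φ(z) exp(-(i z D + r I) x)` converges for some `r > 0`
and all such `z`, and `φ` is upper triangular with unit diagonal. -/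
def IsWeylFunction {m : ℕ} (d : Fin m → ℝ) (ζ : ℝ → Matrix (Fin m) (Fin m) ℂ) (M : ℝ)
    (φ : ℂ → Matrix (Fin m) (Fin m) ℂ) : Prop :=
  AnalyticOnNhd ℂ φ (lowerHalfPlane M) ∧
  (∃ r : ℝ, 0 < r ∧ ∀ z ∈ lowerHalfPlane M,
    ∃ w : ℝ → Matrix (Fin m) (Fin m) ℂ, IsFundamentalSolution d ζ (Set.Ici 0) z w ∧
      MeasureTheory.IntegrableOn
        (fun x : ℝ =>
          NormedSpace.exp ((Complex.I * (starRingEnd ℂ) z * (x : ℂ)) • diagMat d)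
            * (φ z)ᴴ * (w x)ᴴ * w x * φ z
            * NormedSpace.exp (-((x : ℂ) • ((Complex.I * z) • diagMat d
                + (r : ℂ) • (1 : Matrix (Fin m) (Fin m) ℂ)))))
        (Set.Ioi 0)) ∧
  ∀ z ∈ lowerHalfPlane M, ∀ i j : Fin m,
    (i = j → φ z i j = 1) ∧ (j < i → φ z i j = 0)

/-- `[I_k 0] A [0; I_{m-k}]`: the rows of `A` with (zero-based) index `< k` and its columns
with index `≥ k`. -/
def upperBlock {m : ℕ} (k : Fin m) (A : Matrix (Fin m) (Fin m) ℂ) :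
    Matrix {i : Fin m // i < k} {j : Fin m // k ≤ j} ℂ :=
  A.toBlock (fun i => i < k) (fun j => k ≤ j)

/-- `[0 I_{m-k}] A [0; I_{m-k}]`: the rows and columns of `A` with (zero-based) index `≥ k`. -/
def lowerBlock {m : ℕ} (k : Fin m) (A : Matrix (Fin m) (Fin m) ℂ) :
    Matrix {i : Fin m // k ≤ i} {j : Fin m // k ≤ j} ℂ :=
  A.toBlock (fun i => k ≤ i) (fun j => k ≤ j)

/-- The linear-fractional expression
`[I_k 0] A [0; I_{m-k}] ([0 I_{m-k}] A [0; I_{m-k}])⁻¹`, a `k × (m-k)` matrix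
(meaningful when `lowerBlock k A` is invertible). -/
def psiBreve {m : ℕ} (k : Fin m) (A : Matrix (Fin m) (Fin m) ℂ) :
    Matrix {i : Fin m // i < k} {j : Fin m // k ≤ j} ℂ :=
  upperBlock k A * (lowerBlock k A)⁻¹

end NWave

end

/-! Write η = -Im z > 0. Without ζ the i-th component of a solution grows like exp(η d_i x), so a
gap of the spectrum of D splits solutions into fast ones (i < k, zero-based) and slow ones (i ≥ k).
Let c be the midpoint and g the half-width of the gap between d_{k-1} and d_k. The condition on M
says exactly that M₀ < M g, so for Im z < -M the perturbation ζ cannot destroy the splitting.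

The tool is the indefinite form `coneForm k`, with sign + on the fast and - on the slow coordinates.
Along every solution exp(-2ηcx) `coneForm k` increases, with derivative at least 2(ηg - M₀)
exp(-2ηcx)‖u‖² (`hasDerivWithinAt_exp_mul_coneForm`). Hence a solution stays in the cone {`coneForm
k` ≤ 0} for all x ≥ 0 if and only if exp(-ηcx) u is square integrable (`IsDecaying.coneForm_nonpos`,
`isDecaying_of_coneForm_nonpos`). An initial value of such a solution is determined by its
coordinates of index ≥ k (`eq_of_isDecaying`): a difference with only fast coordinates has positive
form, unless it is zero.

Existence. For each length l there is a vector with lower part e_k whose solution has vanishing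
upper part at l. These vectors converge as l → ∞ at a rate uniform in z (`exists_weylVector`,
`differentiableOn_weylVector`), so the limit is holomorphic; it is column k of φ. The cone also
bounds the growth of the column, and this gives the Weyl integral. Uniqueness: the Weyl integral
with parameter r gives decay at rate η d_k + r/2, which is at most ηc for large η; the identity
theorem does the rest (`IsWeylFunction.eqOn`).

Evolution. The N-wave equation is the zero curvature condition of the x-system and an auxiliary
t-system, whence w(x,t) R(t) = R(x,t) w(x,0) (`fundamentalSolution_factorization`), where R(x,t) is
bounded in x because ϱ is. So R(t,z) maps decaying initial values at time 0 to decaying ones at time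
t, with the same rate. The columns of index ≥ k of R(t,z)φ(0,z) are therefore decaying at time t,
and column k of φ(t,z) is their combination with lower part e_k; solving for the coefficients is the
linear-fractional formula (`psiBreve_mulVec_single`). -/

section

/-! ### Linear differential equations: Picard series, Grönwall bounds, dependence on parameters. -/

open Set Filter Topology

/-- The terms of the Picard series of the linear equation `y' = A y`, `y 0 = y₀`. -/
noncomputable def picardTerm {E : Type*} [NormedAddCommGroup E] [NormedSpace ℝ E]
    (A : ℝ → E →L[ℝ] E) (y₀ : E) : ℕ → ℝ → E
  | 0 => fun _ => y₀
  | n + 1 => fun x => ∫ s in (0 : ℝ)..x, A s (picardTerm A y₀ n s)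

section LinearODE

variable {E : Type*} [NormedAddCommGroup E] [NormedSpace ℝ E]

lemma continuous_picardTerm [CompleteSpace E] {A : ℝ → E →L[ℝ] E} (hA : Continuous A) (y₀ : E)
    (n : ℕ) : Continuous (picardTerm A y₀ n) := by
  induction n with
  | zero => exact continuous_const
  | succ n ih =>
    exact intervalIntegral.continuous_primitive
      (fun a b => (hA.clm_apply ih).intervalIntegrable a b) 0

lemma hasDerivAt_picardTerm_succ [CompleteSpace E] {A : ℝ → E →L[ℝ] E} (hA : Continuous A)
    (y₀ : E) (n : ℕ) (x : ℝ) :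
    HasDerivAt (picardTerm A y₀ (n + 1)) (A x (picardTerm A y₀ n x)) x :=
  (hA.clm_apply (continuous_picardTerm hA y₀ n)).integral_hasStrictDerivAt 0 x |>.hasDerivAt

/-- The n-fold iterated integral produces the factorial, so the series converges on the whole line
and not only for short times. -/
lemma norm_picardTerm_le {A : ℝ → E →L[ℝ] E} {y₀ : E} {K ρ : ℝ} (hK : 0 ≤ K)
    (hA : ∀ x, |x| ≤ ρ → ‖A x‖ ≤ K) (n : ℕ) (x : ℝ) (hx : |x| ≤ ρ) :
    ‖picardTerm A y₀ n x‖ ≤ ‖y₀‖ * ((K * |x|) ^ n / n.factorial) := by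
  induction n generalizing x with
  | zero => simp [picardTerm]
  | succ n ih =>
    have h1 : ‖picardTerm A y₀ (n + 1) x‖
        ≤ ∫ s in uIoc 0 x, K * (‖y₀‖ * (K ^ n / n.factorial)) * |s - 0| ^ n := by
      rw [picardTerm, intervalIntegral.norm_integral_eq_norm_integral_uIoc]
      refine MeasureTheory.norm_integral_le_of_norm_le ?_ ?_
      · exact ((by fun_prop : Continuous fun s : ℝ =>
          K * (‖y₀‖ * (K ^ n / n.factorial)) * |s - 0| ^ n).intervalIntegrable 0 x).def'
      · refine (MeasureTheory.ae_restrict_iff' measurableSet_uIoc).2 (.of_forall fun s hs => ?_)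
        have hs' : |s| ≤ |x| := by
          rcases le_total 0 x with h | h
          · rw [uIoc_of_le h] at hs
            rw [abs_of_pos hs.1, abs_of_nonneg h]; exact hs.2
          · rw [uIoc_of_ge h] at hs
            rw [abs_of_nonpos hs.2, abs_of_nonpos h]; linarith [hs.1]
        calc ‖A s (picardTerm A y₀ n s)‖ ≤ ‖A s‖ * ‖picardTerm A y₀ n s‖ := (A s).le_opNorm _
          _ ≤ K * (‖y₀‖ * ((K * |s|) ^ n / n.factorial)) :=
              mul_le_mul (hA s (hs'.trans hx)) (ih s (hs'.trans hx)) (norm_nonneg _) hK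
          _ = _ := by rw [sub_zero, mul_pow]; ring
    refine h1.trans (le_of_eq ?_)
    rw [MeasureTheory.integral_const_mul, integral_pow_abs_sub_uIoc, sub_zero, Nat.factorial_succ,
      Nat.cast_mul, Nat.cast_succ]
    have := Nat.factorial_pos n
    rw [mul_pow]
    field_simp
    ring

/-- Linear equations with continuous coefficients have global solutions. -/
theorem exists_linearODE_solution [CompleteSpace E] {A : ℝ → E →L[ℝ] E} (hA : Continuous A)
    (y₀ : E) : ∃ y : ℝ → E, y 0 = y₀ ∧ ∀ x, HasDerivAt y (A x (y x)) x := by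
  have hbound : ∀ ρ : ℝ, ∃ K, 0 ≤ K ∧ ∀ x, |x| ≤ ρ → ‖A x‖ ≤ K := by
    intro ρ
    obtain ⟨K, hK⟩ := (isCompact_Icc (a := -ρ) (b := ρ)).exists_bound_of_continuousOn
      hA.continuousOn
    exact ⟨max K 0, le_max_right _ _, fun x hx => (hK x (abs_le.1 hx)).trans (le_max_left _ _)⟩
  have hsum : ∀ x, Summable fun n => picardTerm A y₀ n x := by
    intro x
    obtain ⟨K, hK0, hK⟩ := hbound |x|
    exact .of_norm_bounded ((Real.summable_pow_div_factorial (K * |x|)).mul_left ‖y₀‖)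
      fun n => norm_picardTerm_le hK0 hK n x le_rfl
  refine ⟨fun x => ∑' n, picardTerm A y₀ n x, ?_, fun x => ?_⟩
  · beta_reduce
    rw [tsum_eq_single 0]
    · rfl
    · intro n hn
      obtain ⟨k, rfl⟩ := Nat.exists_eq_succ_of_ne_zero hn
      simp [picardTerm]
  · obtain ⟨K, hK0, hK⟩ := hbound (|x| + 1)
    have hle : ∀ n, ∀ y ∈ Ioo (-(|x| + 1)) (|x| + 1), ‖A y (picardTerm A y₀ n y)‖
        ≤ K * (‖y₀‖ * ((K * (|x| + 1)) ^ n / n.factorial)) := by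
      intro n y hy
      have hy' : |y| ≤ |x| + 1 := (abs_lt.2 hy).le
      refine ((A y).le_opNorm _).trans (mul_le_mul (hK y hy') ?_ (norm_nonneg _) hK0)
      refine (norm_picardTerm_le hK0 hK n y hy').trans ?_
      have : (K * |y|) ^ n ≤ (K * (|x| + 1)) ^ n :=
        pow_le_pow_left₀ (by positivity) (mul_le_mul_of_nonneg_left hy' hK0) n
      gcongr
    have hx : x ∈ Ioo (-(|x| + 1)) (|x| + 1) := abs_lt.1 (lt_add_one |x|)
    have hder : HasDerivAt (fun x => ∑' n, picardTerm A y₀ (n + 1) x)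
        (∑' n, A x (picardTerm A y₀ n x)) x :=
      hasDerivAt_tsum_of_isPreconnected
        (((Real.summable_pow_div_factorial (K * (|x| + 1))).mul_left ‖y₀‖).mul_left K)
        isOpen_Ioo isPreconnected_Ioo
        (fun n y _ => hasDerivAt_picardTerm_succ hA y₀ n y) hle hx
        ((summable_nat_add_iff 1).2 (hsum x)) hx
    have heq : (fun x => ∑' n, picardTerm A y₀ n x)
        = fun x => y₀ + ∑' n, picardTerm A y₀ (n + 1) x := by
      funext x
      rw [(hsum x).tsum_eq_zero_add]
      rfl
    rw [ContinuousLinearMap.map_tsum _ (hsum x), heq]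
    exact hder.const_add y₀

/-- A form of Grönwall's inequality on `[0, T]`. -/
theorem norm_le_mul_exp_of_norm_deriv_le {y y' : ℝ → E} {δ ε K T : ℝ} (hK : 1 ≤ K) (hδ : 0 ≤ δ)
    (hε : 0 ≤ ε) (hy : ∀ x ∈ Icc 0 T, HasDerivWithinAt y (y' x) (Icc 0 T) x)
    (h0 : ‖y 0‖ ≤ δ) (hb : ∀ x ∈ Icc 0 T, ‖y' x‖ ≤ K * ‖y x‖ + ε) :
    ∀ x ∈ Icc 0 T, ‖y x‖ ≤ (δ + ε) * Real.exp (K * T) := by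
  intro x hx
  have h := norm_le_gronwallBound_of_norm_deriv_right_le (f := y) (f' := y') (δ := δ) (K := K)
    (ε := ε) (a := 0) (b := T) (fun x hx => (hy x hx).continuousWithinAt)
    (fun x hx => ((hy x ⟨hx.1, hx.2.le⟩).mono_of_mem_nhdsWithin
      (mem_of_superset (Icc_mem_nhdsGE hx.2) (Icc_subset_Icc_left hx.1)))) h0
    (fun x hx => hb x ⟨hx.1, hx.2.le⟩) x hx
  rw [gronwallBound_of_K_ne_0 (by positivity), sub_zero] at h
  have h1 : Real.exp (K * x) ≤ Real.exp (K * T) :=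
    Real.exp_le_exp.2 (mul_le_mul_of_nonneg_left hx.2 (by positivity))
  have h2 : ε / K ≤ ε := div_le_self hε hK
  have h3 : 1 ≤ Real.exp (K * x) := Real.one_le_exp (mul_nonneg (by positivity) hx.1)
  have h4 : 0 ≤ ε / K := by positivity
  nlinarith [Real.exp_pos (K * x)]

end LinearODE

section Algebra

variable {𝔸 : Type*} [NormedRing 𝔸] [NormedAlgebra ℝ 𝔸]

theorem norm_solution_le {A W : ℝ → 𝔸} {K c T : ℝ} (hK : 1 ≤ K)
    (hA : ∀ s ∈ Icc 0 T, ‖A s‖ ≤ K) (h0 : ‖W 0‖ ≤ c)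
    (hW : ∀ s ∈ Icc 0 T, HasDerivWithinAt W (A s * W s) (Icc 0 T) s) :
    ∀ s ∈ Icc 0 T, ‖W s‖ ≤ c * Real.exp (K * T) := by
  intro s hs
  simpa using norm_le_mul_exp_of_norm_deriv_le hK ((norm_nonneg _).trans h0) le_rfl hW h0
    (fun s hs => by
      rw [add_zero]
      exact (norm_mul_le _ _).trans (mul_le_mul_of_nonneg_right (hA s hs) (norm_nonneg _))) s hs

theorem linearODE_solution_unique {A W W' : ℝ → 𝔸} {K T : ℝ}
    (hA : ∀ s ∈ Icc 0 T, ‖A s‖ ≤ K) (h0 : W 0 = W' 0)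
    (hW : ∀ s ∈ Icc 0 T, HasDerivWithinAt W (A s * W s) (Icc 0 T) s)
    (hW' : ∀ s ∈ Icc 0 T, HasDerivWithinAt W' (A s * W' s) (Icc 0 T) s) :
    EqOn W W' (Icc 0 T) := by
  intro s hs
  have := norm_solution_le (A := A) (W := W - W') (c := 0) (le_max_right K 1)
    (fun s hs => (hA s hs).trans (le_max_left _ _)) (by simp [h0])
    (fun s hs => by rw [Pi.sub_apply, mul_sub]; exact (hW s hs).sub (hW' s hs)) s hs
  rw [zero_mul, norm_le_zero_iff] at this
  exact sub_eq_zero.1 this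

/-- The error W₁ - W - S solves the equation with coefficient A and inhomogeneity (A₁ - A - B) W +
(A₁ - A)(W₁ - W). The second product is of order δ², since W₁ - W is itself of order δ; two
applications of Grönwall give the bound. -/
theorem norm_solution_sub_linearization_le {A A₁ B W W₁ S : ℝ → 𝔸} {K c δ η T : ℝ} (hK : 1 ≤ K)
    (hδ : 0 ≤ δ) (hη : 0 ≤ η)
    (hA : ∀ s ∈ Icc 0 T, ‖A s‖ ≤ K) (hA₁ : ∀ s ∈ Icc 0 T, ‖A₁ s‖ ≤ K)
    (hAδ : ∀ s ∈ Icc 0 T, ‖A₁ s - A s‖ ≤ δ) (hAη : ∀ s ∈ Icc 0 T, ‖A₁ s - A s - B s‖ ≤ η)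
    (hc : ‖W 0‖ ≤ c) (h0 : W₁ 0 = W 0) (hS0 : S 0 = 0)
    (hW : ∀ s ∈ Icc 0 T, HasDerivWithinAt W (A s * W s) (Icc 0 T) s)
    (hW₁ : ∀ s ∈ Icc 0 T, HasDerivWithinAt W₁ (A₁ s * W₁ s) (Icc 0 T) s)
    (hS : ∀ s ∈ Icc 0 T, HasDerivWithinAt S (A s * S s + B s * W s) (Icc 0 T) s) :
    ∀ s ∈ Icc 0 T, ‖W₁ s - W s - S s‖
      ≤ (η + δ * δ * Real.exp (K * T)) * c * Real.exp (K * T) * Real.exp (K * T) := by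
  have hc0 : 0 ≤ c := (norm_nonneg _).trans hc
  have hWb := norm_solution_le hK hA hc hW
  have hW₁b := norm_solution_le hK hA₁ (h0 ▸ hc) hW₁
  have hD : ∀ s ∈ Icc 0 T, ‖W₁ s - W s‖ ≤ (0 + δ * (c * Real.exp (K * T))) * Real.exp (K * T) := by
    refine norm_le_mul_exp_of_norm_deriv_le hK le_rfl (by positivity)
      (fun s hs => (hW₁ s hs).sub (hW s hs)) (by simp [h0]) fun s hs => ?_
    rw [show A₁ s * W₁ s - A s * W s = A s * (W₁ s - W s) + (A₁ s - A s) * W₁ s by noncomm_ring]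
    refine (norm_add_le _ _).trans (add_le_add ?_ ?_)
    · exact (norm_mul_le _ _).trans (mul_le_mul_of_nonneg_right (hA s hs) (norm_nonneg _))
    · exact (norm_mul_le _ _).trans (mul_le_mul (hAδ s hs) (hW₁b s hs) (norm_nonneg _) hδ)
  intro s hs
  have := norm_le_mul_exp_of_norm_deriv_le (y := fun s => W₁ s - W s - S s) (δ := 0)
    (ε := η * (c * Real.exp (K * T)) + δ * ((0 + δ * (c * Real.exp (K * T))) * Real.exp (K * T)))
    hK le_rfl (by positivity) (fun s hs => ((hW₁ s hs).sub (hW s hs)).sub (hS s hs))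
    (by simp [h0, hS0]) (fun s hs => by
      rw [show A₁ s * W₁ s - A s * W s - (A s * S s + B s * W s)
        = A s * (W₁ s - W s - S s)
          + ((A₁ s - A s - B s) * W s + (A₁ s - A s) * (W₁ s - W s)) by noncomm_ring]
      refine (norm_add_le _ _).trans (add_le_add ?_ ((norm_add_le _ _).trans (add_le_add ?_ ?_)))
      · exact (norm_mul_le _ _).trans (mul_le_mul_of_nonneg_right (hA s hs) (norm_nonneg _))
      · exact (norm_mul_le _ _).trans (mul_le_mul (hAη s hs) (hWb s hs) (norm_nonneg _) hη)
      · exact (norm_mul_le _ _).trans (mul_le_mul (hAδ s hs) (hD s hs) (norm_nonneg _) hδ)) s hs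
  refine this.trans (le_of_eq ?_)
  ring

/-- Differentiability of the solution of a linear equation with respect to a parameter. -/
theorem hasDerivWithinAt_solution_of_param {𝕜 : Type*} [NontriviallyNormedField 𝕜]
    [NormedAlgebra 𝕜 𝔸] [SMulCommClass ℝ 𝕜 𝔸] {P : Set 𝕜} {p : 𝕜} (hp : p ∈ P)
    {A W : 𝕜 → ℝ → 𝔸}
    {B S : ℝ → 𝔸} {T : ℝ} (hT : 0 ≤ T) {K : ℝ} (hA : ∀ s ∈ Icc 0 T, ‖A p s‖ ≤ K)
    (hB : ∀ s ∈ Icc 0 T, ‖B s‖ ≤ K) (h0 : ∀ q ∈ P, W q 0 = W p 0) (hS0 : S 0 = 0)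
    (hAB : ∀ ε > 0, ∀ᶠ q in 𝓝[P] p, ∀ s ∈ Icc 0 T,
      ‖A q s - A p s - (q - p) • B s‖ ≤ ε * ‖q - p‖)
    (hW : ∀ q ∈ P, ∀ s ∈ Icc 0 T, HasDerivWithinAt (W q) (A q s * W q s) (Icc 0 T) s)
    (hS : ∀ s ∈ Icc 0 T, HasDerivWithinAt S (A p s * S s + B s * W p s) (Icc 0 T) s) :
    HasDerivWithinAt (fun q => W q T) (S T) P p := by
  have hK0 : 0 ≤ K := (norm_nonneg _).trans (hA 0 ⟨le_rfl, hT⟩)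
  rw [hasDerivWithinAt_iff_isLittleO, Asymptotics.isLittleO_iff]
  intro c' hc'
  -- For ‖q - p‖ ≤ 1 the norm of A q is at most K + (K + 1).
  set N := 2 * K + 1 with hN
  have hN1 : 1 ≤ N := by linarith
  set e := Real.exp (N * T)
  have he : 0 < e := Real.exp_pos _
  set c := ‖W p 0‖
  -- ε and r make the first-order and the quadratic error terms at most c'/2 times ‖q - p‖ each; the
  -- summand 1 guards against a zero denominator.
  set ε := c' / (2 * (c * e * e + 1)) with hε
  have hεpos : 0 < ε := by positivity
  set r := c' / (2 * (N * N * e * c * e * e + 1)) with hr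
  have hrpos : 0 < r := by positivity
  have hball : ∀ᶠ q in 𝓝[P] p, ‖q - p‖ < min 1 r := by
    have : Metric.ball p (min 1 r) ∈ 𝓝[P] p :=
      mem_nhdsWithin_of_mem_nhds (Metric.ball_mem_nhds p (by positivity))
    filter_upwards [this] with q hq
    rwa [Metric.mem_ball, dist_eq_norm] at hq
  filter_upwards [hAB 1 one_pos, hAB ε hεpos, hball, self_mem_nhdsWithin] with q h1 h2 h3 hq
  have hq1 : ‖q - p‖ ≤ 1 := h3.le.trans (min_le_left _ _)
  have hqr : ‖q - p‖ ≤ r := h3.le.trans (min_le_right _ _)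
  have hdiff : ∀ s ∈ Icc 0 T, ‖A q s - A p s‖ ≤ (K + 1) * ‖q - p‖ := by
    intro s hs
    have h4 : ‖(q - p) • B s‖ ≤ ‖q - p‖ * K := by
      rw [norm_smul]; exact mul_le_mul_of_nonneg_left (hB s hs) (norm_nonneg _)
    have := norm_add_le (A q s - A p s - (q - p) • B s) ((q - p) • B s)
    rw [sub_add_cancel] at this
    linarith [h1 s hs]
  have hdN : ∀ s ∈ Icc 0 T, ‖A q s - A p s‖ ≤ N * ‖q - p‖ := fun s hs =>
    (hdiff s hs).trans (mul_le_mul_of_nonneg_right (by linarith) (norm_nonneg _))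
  have key := norm_solution_sub_linearization_le (A := A p) (A₁ := A q)
    (B := fun s => (q - p) • B s) (W := W p) (W₁ := W q) (S := fun s => (q - p) • S s) (K := N)
    (c := c) (δ := N * ‖q - p‖) (η := ε * ‖q - p‖) (T := T) hN1 (by positivity) (by positivity)
    (fun s hs => (hA s hs).trans (by linarith))
    (fun s hs => by
      have := norm_add_le (A q s - A p s) (A p s)
      rw [sub_add_cancel] at this
      nlinarith [hdiff s hs, hA s hs])
    hdN h2 le_rfl (h0 q hq) (by simp [hS0]) (hW p hp) (hW q hq)
    (fun s hs => by
      have := (hS s hs).const_smul (q - p)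
      rwa [smul_add, ← mul_smul_comm, ← smul_mul_assoc (q - p) (B s)] at this) T ⟨hT, le_rfl⟩
  refine key.trans ?_
  have e1 : ε * (c * e * e) ≤ c' / 2 := by
    rw [hε, div_mul_eq_mul_div, div_le_div_iff₀ (by positivity) (by positivity)]
    nlinarith [show 0 ≤ c * e * e by positivity]
  have e2 : r * (N * N * e * c * e * e) ≤ c' / 2 := by
    rw [hr, div_mul_eq_mul_div, div_le_div_iff₀ (by positivity) (by positivity)]
    nlinarith [show 0 ≤ N * N * e * c * e * e by positivity]
  have e3 : ‖q - p‖ * (N * N * e * c * e * e) ≤ c' / 2 :=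
    (mul_le_mul_of_nonneg_right hqr (by positivity)).trans e2
  calc _ = (ε * (c * e * e) + ‖q - p‖ * (N * N * e * c * e * e)) * ‖q - p‖ := by ring
    _ ≤ _ := mul_le_mul_of_nonneg_right (by linarith) (norm_nonneg _)

end Algebra

/-! ### Indefinite forms along solutions: cones and decay. -/

namespace NWave

variable {m : ℕ}

/-- `u` is a vector solution of `u_x = (i z D - ζ(x)) u` on `[0, ∞)`. -/
def IsVectorSolution (d : Fin m → ℝ) (ζ : ℝ → Matrix (Fin m) (Fin m) ℂ) (z : ℂ)
    (u : ℝ → EuclideanSpace ℂ (Fin m)) : Prop :=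
  ∀ x ∈ Ici (0 : ℝ), HasDerivWithinAt u
    (Matrix.toEuclideanCLM (𝕜 := ℂ) ((Complex.I * z) • diagMat d - ζ x) (u x)) (Ici 0) x

/-- The diagonal quadratic form with weights `s`. -/
noncomputable def weightedSq (s : Fin m → ℝ) (u : EuclideanSpace ℂ (Fin m)) : ℝ :=
  ∑ i, s i * ‖u i‖ ^ 2

/-- The indefinite form `∑_{i < k} |u_i|² - ∑_{i ≥ k} |u_i|²`. -/
noncomputable def coneForm (k : Fin m) : EuclideanSpace ℂ (Fin m) → ℝ :=
  weightedSq fun i => if i < k then 1 else -1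

/-- The function `exp (-κ x) u(x)` is square integrable on the half-line. -/
def IsDecaying (κ : ℝ) (u : ℝ → EuclideanSpace ℂ (Fin m)) : Prop :=
  MeasureTheory.MemLp (fun x => Real.exp (-(κ * x)) • u x) 2
    (MeasureTheory.volume.restrict (Ioi 0))

section Solutions

variable {d : Fin m → ℝ} {ζ : ℝ → Matrix (Fin m) (Fin m) ℂ} {z : ℂ}
  {u v : ℝ → EuclideanSpace ℂ (Fin m)}

lemma IsVectorSolution.sub (hu : IsVectorSolution d ζ z u) (hv : IsVectorSolution d ζ z v) :
    IsVectorSolution d ζ z (fun x => u x - v x) := fun x hx => by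
  rw [map_sub]; exact (hu x hx).sub (hv x hx)

lemma IsVectorSolution.continuousOn (hu : IsVectorSolution d ζ z u) : ContinuousOn u (Ici 0) :=
  fun x hx => (hu x hx).continuousWithinAt

lemma IsFundamentalSolution.isVectorSolution {w : ℝ → Matrix (Fin m) (Fin m) ℂ}
    (hw : IsFundamentalSolution d ζ (Ici 0) z w) (f : EuclideanSpace ℂ (Fin m)) :
    IsVectorSolution d ζ z (fun x => Matrix.toEuclideanCLM (𝕜 := ℂ) (w x) f) := by
  intro x hx
  let Λ : Matrix (Fin m) (Fin m) ℂ →L[ℝ] EuclideanSpace ℂ (Fin m) :=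
    LinearMap.toContinuousLinearMap
      { toFun := fun A => Matrix.toEuclideanCLM (𝕜 := ℂ) A f
        map_add' := fun A B => by simp
        map_smul' := fun r A => by
          ext i
          simp [Matrix.smul_mulVec] }
  have h := Λ.hasFDerivAt.comp_hasDerivWithinAt x (hw.2 x hx)
  have e : Λ (((Complex.I * z) • diagMat d - ζ x) * w x)
      = Matrix.toEuclideanCLM (𝕜 := ℂ) ((Complex.I * z) • diagMat d - ζ x)
        (Matrix.toEuclideanCLM (𝕜 := ℂ) (w x) f) := by
    change Matrix.toEuclideanCLM (𝕜 := ℂ) _ f = _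
    rw [map_mul]; rfl
  rw [e] at h
  exact h

lemma weightedSq_one (u : EuclideanSpace ℂ (Fin m)) : weightedSq (fun _ => 1) u = ‖u‖ ^ 2 := by
  simp [weightedSq, EuclideanSpace.norm_sq_eq]

lemma weightedSq_mono {s t : Fin m → ℝ} (h : ∀ i, s i ≤ t i) (u : EuclideanSpace ℂ (Fin m)) :
    weightedSq s u ≤ weightedSq t u :=
  Finset.sum_le_sum fun i _ => mul_le_mul_of_nonneg_right (h i) (sq_nonneg _)

lemma weightedSq_const_mul (c : ℝ) (s : Fin m → ℝ) (u : EuclideanSpace ℂ (Fin m)) :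
    weightedSq (fun i => c * s i) u = c * weightedSq s u := by
  simp only [weightedSq, Finset.mul_sum, mul_assoc]

lemma weightedSq_sub (s t : Fin m → ℝ) (u : EuclideanSpace ℂ (Fin m)) :
    weightedSq (fun i => s i - t i) u = weightedSq s u - weightedSq t u := by
  simp only [weightedSq, ← Finset.sum_sub_distrib, sub_mul]

lemma continuous_weightedSq (s : Fin m → ℝ) : Continuous (weightedSq s) := by
  unfold weightedSq; fun_prop

lemma coneForm_le (k : Fin m) (u : EuclideanSpace ℂ (Fin m)) : coneForm k u ≤ ‖u‖ ^ 2 := by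
  rw [← weightedSq_one]
  exact weightedSq_mono (fun i => by split_ifs <;> norm_num) u

lemma coneForm_of_lower_eq_zero {k : Fin m} {u : EuclideanSpace ℂ (Fin m)}
    (h : ∀ i, k ≤ i → u i = 0) : coneForm k u = ‖u‖ ^ 2 := by
  rw [← weightedSq_one]
  unfold coneForm weightedSq
  refine Finset.sum_congr rfl fun i _ => ?_
  beta_reduce
  split_ifs with hi
  · rfl
  · simp [h i (not_lt.1 hi)]

lemma coneForm_of_upper_eq_zero {k : Fin m} {u : EuclideanSpace ℂ (Fin m)}
    (h : ∀ i, i < k → u i = 0) : coneForm k u = -‖u‖ ^ 2 := by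
  rw [← weightedSq_one, ← neg_one_mul, ← weightedSq_const_mul]
  unfold coneForm weightedSq
  refine Finset.sum_congr rfl fun i _ => ?_
  beta_reduce
  split_ifs with hi
  · simp [h i hi]
  · simp

lemma abs_sum_re_conj_mul_le {s : Fin m → ℝ} (hs : ∀ i, |s i| ≤ 1)
    (u v : EuclideanSpace ℂ (Fin m)) :
    |∑ i, s i * ((starRingEnd ℂ) (u i) * v i).re| ≤ ‖u‖ * ‖v‖ := by
  calc |∑ i, s i * ((starRingEnd ℂ) (u i) * v i).re|
      ≤ ∑ i, ‖u i‖ * ‖v i‖ := by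
        refine (Finset.abs_sum_le_sum_abs _ _).trans (Finset.sum_le_sum fun i _ => ?_)
        rw [abs_mul]
        have h := Complex.abs_re_le_norm ((starRingEnd ℂ) (u i) * v i)
        rw [norm_mul, RCLike.norm_conj] at h
        calc |s i| * _ ≤ 1 * _ := mul_le_mul_of_nonneg_right (hs i) (abs_nonneg _)
          _ ≤ _ := by rwa [one_mul]
    _ ≤ √(∑ i, ‖u i‖ ^ 2) * √(∑ i, ‖v i‖ ^ 2) := Real.sum_mul_le_sqrt_mul_sqrt _ _ _
    _ = ‖u‖ * ‖v‖ := by rw [EuclideanSpace.norm_eq, EuclideanSpace.norm_eq]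

/-- The diagonal part i z D contributes 2(-Im z) d_i s_i to the i-th weight; the contribution e of ζ
is controlled by Cauchy–Schwarz. -/
lemma hasDerivWithinAt_weightedSq {s : Fin m → ℝ} (hs : ∀ i, |s i| ≤ 1) {M₀ : ℝ}
    (hζ : ∀ x, 0 ≤ x → ‖ζ x‖ ≤ M₀) (hu : IsVectorSolution d ζ z u) {x : ℝ} (hx : 0 ≤ x) :
    ∃ e : ℝ, |e| ≤ 2 * M₀ * ‖u x‖ ^ 2 ∧
      HasDerivWithinAt (fun x => weightedSq s (u x))
        (2 * (-z.im) * weightedSq (fun i => d i * s i) (u x) - e) (Ici 0) x := by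
  set v := Matrix.toEuclideanCLM (𝕜 := ℂ) (ζ x) (u x) with hv
  have hvn : ‖v‖ ≤ M₀ * ‖u x‖ :=
    (ContinuousLinearMap.le_opNorm _ _).trans
      (mul_le_mul_of_nonneg_right ((Matrix.l2_opNorm_toEuclideanCLM (ζ x)).le.trans (hζ x hx))
        (norm_nonneg _))
  refine ⟨2 * ∑ i, s i * ((starRingEnd ℂ) (u x i) * v i).re, ?_, ?_⟩
  · rw [abs_mul, abs_two, mul_assoc]
    refine mul_le_mul_of_nonneg_left ((abs_sum_re_conj_mul_le hs _ _).trans ?_) zero_le_two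
    nlinarith [norm_nonneg (u x)]
  · have hcoord : ∀ i, HasDerivWithinAt (fun x => u x i)
        (Complex.I * z * d i * u x i - v i) (Ici 0) x := by
      intro i
      have h := ((EuclideanSpace.proj (𝕜 := ℂ) i :
        EuclideanSpace ℂ (Fin m) →L[ℂ] ℂ).restrictScalars ℝ).hasFDerivAt
        |>.comp_hasDerivWithinAt x (hu x hx)
      refine h.congr_deriv ?_
      change (Matrix.toEuclideanCLM (𝕜 := ℂ) ((Complex.I * z) • diagMat d - ζ x) (u x)) i = _
      rw [map_sub, sub_apply, ← hv, PiLp.sub_apply]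
      congr 1
      simp [diagMat, Matrix.mulVec_diagonal, mul_assoc]
    have hsum : HasDerivWithinAt (fun x => weightedSq s (u x))
        (∑ i, s i * (2 * inner ℝ (u x i) (Complex.I * z * d i * u x i - v i))) (Ici 0) x :=
      HasDerivWithinAt.fun_sum fun i _ => ((hcoord i).norm_sq).const_mul (s i)
    refine hsum.congr_deriv ?_
    rw [weightedSq, Finset.mul_sum, Finset.mul_sum, ← Finset.sum_sub_distrib]
    refine Finset.sum_congr rfl fun i _ => ?_
    rw [Complex.inner, Complex.sq_norm, Complex.normSq_apply]
    simp
    ring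


/-- Multiplication by `exp (-2κx)` shifts the weights. -/
lemma hasDerivWithinAt_exp_mul_weightedSq {s : Fin m → ℝ} (hs : ∀ i, |s i| ≤ 1) {M₀ : ℝ}
    (hζ : ∀ x, 0 ≤ x → ‖ζ x‖ ≤ M₀) (hu : IsVectorSolution d ζ z u) (c : ℝ) {x : ℝ}
    (hx : 0 ≤ x) :
    ∃ e : ℝ, |e| ≤ 2 * M₀ * ‖u x‖ ^ 2 ∧
      HasDerivWithinAt (fun x => Real.exp (-(2 * (-z.im) * c * x)) * weightedSq s (u x))
        (Real.exp (-(2 * (-z.im) * c * x))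
          * (2 * (-z.im) * weightedSq (fun i => (d i - c) * s i) (u x) - e)) (Ici 0) x := by
  obtain ⟨e, he, h⟩ := hasDerivWithinAt_weightedSq hs hζ hu hx
  refine ⟨e, he, ?_⟩
  have h1 : HasDerivWithinAt (fun x => Real.exp (-(2 * (-z.im) * c * x)))
      (Real.exp (-(2 * (-z.im) * c * x)) * -(2 * (-z.im) * c)) (Ici 0) x := by
    have := ((hasDerivAt_id x).const_mul (2 * (-z.im) * c)).neg.exp.hasDerivWithinAt (s := Ici 0)
    simpa using this
  refine (h1.mul h).congr_deriv ?_
  simp only [sub_mul, weightedSq_sub, weightedSq_const_mul]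
  ring

/-- The weights of `coneForm k` are separated by a gap of `d` around `c`. -/
def IsSeparated (d : Fin m → ℝ) (k : Fin m) (c g : ℝ) : Prop :=
  ∀ i, (i < k → c + g ≤ d i) ∧ (k ≤ i → d i ≤ c - g)

section Cone

variable {k : Fin m} {c g M₀ : ℝ}

/-- After the shift by c the weights d_i - c have the sign of the form and modulus at least g, so
the diagonal part contributes at least 2(-Im z) g ‖u‖², against which ζ can take away at most 2 M₀
‖u‖². -/
lemma hasDerivWithinAt_exp_mul_coneForm (hsep : IsSeparated d k c g) (hz : z.im ≤ 0)
    (hζ : ∀ x, 0 ≤ x → ‖ζ x‖ ≤ M₀) (hu : IsVectorSolution d ζ z u) {x : ℝ} (hx : 0 ≤ x) :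
    ∃ Q' : ℝ, HasDerivWithinAt (fun x => Real.exp (-(2 * (-z.im) * c * x)) * coneForm k (u x))
        Q' (Ici 0) x ∧
      2 * (-z.im * g - M₀) * (Real.exp (-(2 * (-z.im) * c * x)) * ‖u x‖ ^ 2) ≤ Q' := by
  obtain ⟨e, he, h⟩ := hasDerivWithinAt_exp_mul_weightedSq
    (s := fun i => if i < k then 1 else -1) (fun i => by split_ifs <;> simp) hζ hu c hx
  refine ⟨_, h, ?_⟩
  have h1 : g * ‖u x‖ ^ 2
      ≤ weightedSq (fun i => (d i - c) * if i < k then 1 else -1) (u x) := by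
    rw [← weightedSq_one, ← weightedSq_const_mul]
    refine weightedSq_mono (fun i => ?_) _
    split_ifs with hi
    · linarith [(hsep i).1 hi]
    · linarith [(hsep i).2 (not_lt.1 hi)]
  have h2 := mul_le_mul_of_nonneg_left h1 (show 0 ≤ 2 * (-z.im) by linarith)
  rw [mul_left_comm]
  refine mul_le_mul_of_nonneg_left ?_ (Real.exp_pos _).le
  linarith [le_abs_self e]

lemma monotoneOn_exp_mul_coneForm (hsep : IsSeparated d k c g) (hz : z.im ≤ 0)
    (hε : M₀ ≤ -z.im * g) (hζ : ∀ x, 0 ≤ x → ‖ζ x‖ ≤ M₀) (hu : IsVectorSolution d ζ z u) :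
    MonotoneOn (fun x => Real.exp (-(2 * (-z.im) * c * x)) * coneForm k (u x)) (Ici 0) := by
  choose! Q' hQ' hle using fun x (hx : 0 ≤ x) =>
    hasDerivWithinAt_exp_mul_coneForm hsep hz hζ hu hx
  refine monotoneOn_of_hasDerivWithinAt_nonneg (convex_Ici 0)
    (fun x hx => (hQ' x hx).continuousWithinAt)
    (fun x hx => (hQ' x (interior_subset hx)).mono interior_subset)
    (fun x hx => le_trans ?_ (hle x (interior_subset hx)))
  have : 0 ≤ -z.im * g - M₀ := by linarith
  positivity

lemma coneForm_nonpos_of_le (hsep : IsSeparated d k c g) (hz : z.im ≤ 0)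
    (hε : M₀ ≤ -z.im * g) (hζ : ∀ x, 0 ≤ x → ‖ζ x‖ ≤ M₀) (hu : IsVectorSolution d ζ z u)
    {x l : ℝ} (hx : 0 ≤ x) (hxl : x ≤ l) (hl : coneForm k (u l) ≤ 0) : coneForm k (u x) ≤ 0 := by
  have h := monotoneOn_exp_mul_coneForm hsep hz hε hζ hu hx (hx.trans hxl) hxl
  have h1 : Real.exp (-(2 * (-z.im) * c * l)) * coneForm k (u l) ≤ 0 :=
    mul_nonpos_of_nonneg_of_nonpos (Real.exp_pos _).le hl
  by_contra! hc
  have := mul_pos (Real.exp_pos (-(2 * (-z.im) * c * x))) hc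
  exact absurd (h.trans h1) (not_le.2 this)

lemma isDecaying_iff (hu : ContinuousOn u (Ici 0)) (κ : ℝ) :
    IsDecaying κ u ↔ MeasureTheory.IntegrableOn
      (fun x => Real.exp (-(2 * κ * x)) * ‖u x‖ ^ 2) (Ioi 0) := by
  have hm : MeasureTheory.AEStronglyMeasurable (fun x => Real.exp (-(κ * x)) • u x)
      (MeasureTheory.volume.restrict (Ioi 0)) :=
    ((by fun_prop : Continuous fun x : ℝ => Real.exp (-(κ * x))).continuousOn.smul
      (hu.mono Ioi_subset_Ici_self)).aestronglyMeasurable measurableSet_Ioi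
  rw [IsDecaying, MeasureTheory.memLp_two_iff_integrable_sq_norm hm, MeasureTheory.IntegrableOn]
  refine iff_of_eq (congrArg (fun f => MeasureTheory.Integrable f _) (funext fun x => ?_))
  rw [norm_smul, mul_pow, Real.norm_eq_abs, sq_abs, ← Real.exp_nat_mul]
  congr 2
  push_cast; ring

/-- Were the form positive at x, its weighted value would stay above a positive constant on (x, ∞),
yet it is dominated by an integrable function. -/
lemma IsDecaying.coneForm_nonpos (h : IsDecaying (-z.im * c) u) (hsep : IsSeparated d k c g)
    (hz : z.im ≤ 0) (hε : M₀ ≤ -z.im * g) (hζ : ∀ x, 0 ≤ x → ‖ζ x‖ ≤ M₀)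
    (hu : IsVectorSolution d ζ z u) {x : ℝ} (hx : 0 ≤ x) : coneForm k (u x) ≤ 0 := by
  by_contra! hpos
  set Q := fun x => Real.exp (-(2 * (-z.im) * c * x)) * coneForm k (u x) with hQ
  have hQx : 0 < Q x := mul_pos (Real.exp_pos _) hpos
  have hint := (isDecaying_iff hu.continuousOn _).1 h
  have hconst : MeasureTheory.IntegrableOn (fun _ => Q x) (Ioi x) := by
    refine MeasureTheory.Integrable.mono' (hint.mono_set (Ioi_subset_Ioi hx))
      MeasureTheory.aestronglyMeasurable_const
      ((MeasureTheory.ae_restrict_iff' measurableSet_Ioi).2 (.of_forall fun y hy => ?_))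
    rw [Real.norm_of_nonneg hQx.le]
    refine (monotoneOn_exp_mul_coneForm hsep hz hε hζ hu hx (hx.trans (le_of_lt hy))
      (le_of_lt hy)).trans ?_
    simp only [← mul_assoc]
    exact mul_le_mul_of_nonneg_left (coneForm_le k _) (Real.exp_pos _).le
  rw [MeasureTheory.integrableOn_const_iff] at hconst
  simp [hQx.ne'] at hconst

/-- Integrating the lower bound for the derivative over [0, X] bounds the integral of
exp(-2ηcx)‖u‖², η = -Im z, by the increase of the weighted form, hence by minus its value at 0,
uniformly in X. Here the strict inequality for M₀ is needed. -/
lemma isDecaying_of_coneForm_nonpos (hsep : IsSeparated d k c g) (hz : z.im ≤ 0)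
    (hε : M₀ < -z.im * g) (hζ : ∀ x, 0 ≤ x → ‖ζ x‖ ≤ M₀) (hu : IsVectorSolution d ζ z u)
    (hcone : ∀ x, 0 ≤ x → coneForm k (u x) ≤ 0) : IsDecaying (-z.im * c) u := by
  rw [isDecaying_iff hu.continuousOn]
  simp only [← mul_assoc]
  set n := fun x => Real.exp (-(2 * (-z.im) * c * x)) * ‖u x‖ ^ 2 with hn
  have hncont : ContinuousOn n (Ici 0) :=
    (by fun_prop : Continuous fun x : ℝ => Real.exp (-(2 * (-z.im) * c * x))).continuousOn.mul
      (hu.continuousOn.norm.pow 2)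
  have hε' : 0 < 2 * (-z.im * g - M₀) := by linarith
  choose! Q' hQ' hle using fun x (hx : 0 ≤ x) =>
    hasDerivWithinAt_exp_mul_coneForm hsep hz hζ hu hx
  have hni : ∀ X : ℝ, MeasureTheory.IntegrableOn n (Icc 0 X) := fun X =>
    (hncont.mono Icc_subset_Ici_self).integrableOn_Icc
  refine MeasureTheory.integrableOn_Ioi_of_intervalIntegral_norm_bounded
    (-coneForm k (u 0) / (2 * (-z.im * g - M₀))) 0 (b := fun X : ℝ => X)
    (fun X => (hni X).mono_set Ioc_subset_Icc_self) tendsto_id ?_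
  filter_upwards [eventually_ge_atTop 0] with X hX
  have hnn : ∀ x, ‖n x‖ = n x := fun x => Real.norm_of_nonneg (by positivity)
  simp only [hnn]
  rw [le_div_iff₀ hε', mul_comm, ← intervalIntegral.integral_const_mul]
  have h := intervalIntegral.integral_le_sub_of_hasDeriv_right_of_le hX
    (fun x hx => ((hQ' x hx.1).continuousWithinAt).mono Icc_subset_Ici_self)
    (fun x hx => (hQ' x hx.1.le).mono (Ioi_subset_Ici hx.1.le))
    ((hni X).const_mul (2 * (-z.im * g - M₀))) (fun x hx => hle x hx.1.le)
  refine h.trans ?_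
  have := mul_nonpos_of_nonneg_of_nonpos (Real.exp_pos (-(2 * (-z.im) * c * X))).le (hcone X hX)
  simp only [mul_zero, neg_zero, Real.exp_zero, one_mul]
  linarith

/-- Two solutions with the same lower part at `0` that lie in the cone at `l` are close at `0`. -/
lemma mul_norm_sub_sq_le (hsep : IsSeparated d k c g) (hz : z.im ≤ 0)
    (hε : M₀ ≤ -z.im * g) (hζ : ∀ x, 0 ≤ x → ‖ζ x‖ ≤ M₀) (hu : IsVectorSolution d ζ z u)
    (hv : IsVectorSolution d ζ z v) (huv : ∀ i, k ≤ i → u 0 i = v 0 i) {l : ℝ} (hl : 0 ≤ l)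
    (hul : coneForm k (u l) ≤ 0) (hvl : coneForm k (v l) ≤ 0) :
    (-z.im * g - M₀) * l * ‖u 0 - v 0‖ ^ 2 ≤ -coneForm k (u 0) - coneForm k (v 0) := by
  choose! U' hU' hUle using fun x (hx : 0 ≤ x) =>
    hasDerivWithinAt_exp_mul_coneForm hsep hz hζ hu hx
  choose! V' hV' hVle using fun x (hx : 0 ≤ x) =>
    hasDerivWithinAt_exp_mul_coneForm hsep hz hζ hv hx
  have hε' : 0 ≤ -z.im * g - M₀ := by linarith
  set N := ‖u 0 - v 0‖ ^ 2 with hN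
  -- This function increases: u - v starts in the upper coordinates, so its weighted form never
  -- falls below N. Hence the weighted squares of u and v sum to at least N/2 at every x, and the
  -- derivatives of the two weighted forms to at least (ηg - M₀) N, η = -Im z.
  have hder : ∀ x ∈ Ici (0 : ℝ), HasDerivWithinAt
      (fun x => Real.exp (-(2 * (-z.im) * c * x)) * coneForm k (u x)
        + Real.exp (-(2 * (-z.im) * c * x)) * coneForm k (v x) - (-z.im * g - M₀) * N * x)
      (U' x + V' x - (-z.im * g - M₀) * N * 1) (Ici 0) x := fun x hx =>
    ((hU' x hx).add (hV' x hx)).sub ((hasDerivWithinAt_id x _).const_mul _)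
  have hmono := monotoneOn_of_hasDerivWithinAt_nonneg (convex_Ici 0)
    (fun x hx => (hder x hx).continuousWithinAt)
    (fun x hx => (hder x (interior_subset hx)).mono interior_subset)
    (fun x hx => by
      have hx : 0 ≤ x := interior_subset hx
      have h1 := monotoneOn_exp_mul_coneForm hsep hz hε hζ (hu.sub hv) (mem_Ici.2 le_rfl) hx hx
      simp only [mul_zero, neg_zero, Real.exp_zero, one_mul] at h1
      rw [coneForm_of_lower_eq_zero (u := u 0 - v 0)
        (fun i hi => by rw [PiLp.sub_apply, huv i hi, sub_self])] at h1
      have h2 := mul_le_mul_of_nonneg_left (coneForm_le k (u x - v x))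
        (Real.exp_pos (-(2 * (-z.im) * c * x))).le
      have h3 : ‖u x - v x‖ ^ 2 ≤ 2 * ‖u x‖ ^ 2 + 2 * ‖v x‖ ^ 2 := by
        have := norm_sub_le (u x) (v x)
        nlinarith [norm_nonneg (u x - v x), sq_nonneg (‖u x‖ - ‖v x‖)]
      have h4 := mul_le_mul_of_nonneg_left h3 (Real.exp_pos (-(2 * (-z.im) * c * x))).le
      have h5 := mul_le_mul_of_nonneg_left ((h1.trans h2).trans h4) hε'
      have h6 := hUle x hx
      have h7 := hVle x hx
      rw [← hN] at h5
      linarith)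
  have h := hmono (mem_Ici.2 le_rfl) hl hl
  simp only [mul_zero, neg_zero, Real.exp_zero, one_mul, sub_zero] at h
  have h1 := mul_nonpos_of_nonneg_of_nonpos (Real.exp_pos (-(2 * (-z.im) * c * l))).le hul
  have h2 := mul_nonpos_of_nonneg_of_nonpos (Real.exp_pos (-(2 * (-z.im) * c * l))).le hvl
  linarith

/-- A solution that stays in the cone grows at most like `exp ((-Im z) d_k x + 2 M₀ x)`. -/
lemma norm_sq_le_of_coneForm_nonpos (hd : Antitone d) (hz : z.im ≤ 0) (hM₀ : 0 ≤ M₀)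
    (hζ : ∀ x, 0 ≤ x → ‖ζ x‖ ≤ M₀) (hu : IsVectorSolution d ζ z u)
    (hcone : ∀ x, 0 ≤ x → coneForm k (u x) ≤ 0) {x : ℝ} (hx : 0 ≤ x) :
    ‖u x‖ ^ 2 ≤ 2 * ‖u 0‖ ^ 2 * Real.exp (2 * (-z.im) * d k * x + 4 * M₀ * x) := by
  set s : Fin m → ℝ := fun i => if i < k then 0 else 1 with hs
  have hs1 : ∀ i, |s i| ≤ 1 := fun i => by simp only [hs]; split_ifs <;> simp
  have hlow : ∀ x, 0 ≤ x → ‖u x‖ ^ 2 ≤ 2 * weightedSq s (u x) := by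
    intro x hx
    have h1 : coneForm k (u x) = ‖u x‖ ^ 2 - 2 * weightedSq s (u x) := by
      rw [← weightedSq_one, ← weightedSq_const_mul, ← weightedSq_sub]
      unfold coneForm
      congr 1
      funext i
      simp only [hs]
      split_ifs <;> norm_num
    linarith [hcone x hx]
  choose! e he hder using fun x (hx : 0 ≤ x) => hasDerivWithinAt_weightedSq hs1 hζ hu hx
  -- Rate of the lower part: d i ≤ d k for i ≥ k, and in the cone the contribution of ζ, at most 2
  -- M₀ ‖u‖², is at most 4 M₀ times the lower part.
  set b := 2 * (-z.im) * d k + 4 * M₀ with hb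
  have hexp : ∀ x, HasDerivWithinAt (fun x => Real.exp (-(b * x)))
      (Real.exp (-(b * x)) * -b) (Ici 0) x := by
    intro x
    have := ((hasDerivAt_id x).const_mul b).neg.exp.hasDerivWithinAt (s := Ici 0)
    simpa using this
  have hanti : AntitoneOn (fun x => Real.exp (-(b * x)) * weightedSq s (u x)) (Ici 0) := by
    have hd' := fun x (hx : 0 ≤ x) => (hexp x).mul (hder x hx)
    refine antitoneOn_of_hasDerivWithinAt_nonpos (convex_Ici 0)
      (fun x hx => (hd' x hx).continuousWithinAt)
      (fun x hx => (hd' x (interior_subset hx)).mono interior_subset) fun x hx => ?_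
    have hx : 0 ≤ x := interior_subset hx
    have h1 : weightedSq (fun i => d i * s i) (u x) ≤ d k * weightedSq s (u x) := by
      rw [← weightedSq_const_mul]
      refine weightedSq_mono (fun i => ?_) _
      simp only [hs]
      split_ifs with hi
      · simp
      · simpa using hd (not_lt.1 hi)
    have h2 := mul_le_mul_of_nonneg_left h1 (show 0 ≤ 2 * (-z.im) by linarith)
    have h3 := mul_le_mul_of_nonneg_left (hlow x hx) (show 0 ≤ 2 * M₀ by linarith)
    have h4 := he x hx
    have h5 := neg_abs_le (e x)
    rw [mul_assoc, ← mul_add]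
    refine mul_nonpos_of_nonneg_of_nonpos (Real.exp_pos _).le ?_
    rw [hb]
    linarith
  have h := hanti (mem_Ici.2 le_rfl) hx hx
  simp only [mul_zero, neg_zero, Real.exp_zero, one_mul] at h
  rw [Real.exp_neg, inv_mul_le_iff₀ (Real.exp_pos _)] at h
  have h0 : weightedSq s (u 0) ≤ ‖u 0‖ ^ 2 := by
    rw [← weightedSq_one]
    exact weightedSq_mono (fun i => (le_abs_self _).trans (hs1 i)) _
  have h1 := mul_le_mul_of_nonneg_left h0 (Real.exp_pos (b * x)).le
  have h2 := hlow x hx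
  rw [show 2 * (-z.im) * d k * x + 4 * M₀ * x = b * x by rw [hb]; ring]
  linarith

end Cone

end Solutions

end NWave

/-! ### Fundamental and variational solutions on half-lines and intervals. -/

section Algebra

variable {𝔸 : Type*} [NormedRing 𝔸] [NormedAlgebra ℝ 𝔸] [CompleteSpace 𝔸]

/-- Linear equations on a continuous retract of the line are globally solvable. -/
theorem exists_fundamentalMatrix {G : ℝ → 𝔸} {s : Set ℝ} (ρ : ℝ → ℝ) (hρ : Continuous ρ)
    (hρs : ∀ x, ρ x ∈ s) (hρe : ∀ x ∈ s, ρ x = x) (hG : ContinuousOn G s) :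
    ∃ w : ℝ → 𝔸, w 0 = 1 ∧ ∀ x ∈ s, HasDerivWithinAt w (G x * w x) s x := by
  have hG' : Continuous (fun x => G (ρ x)) := hG.comp_continuous hρ hρs
  obtain ⟨w, hw0, hw⟩ := exists_linearODE_solution
    (A := fun x => ContinuousLinearMap.mul ℝ 𝔸 (G (ρ x)))
    ((ContinuousLinearMap.mul ℝ 𝔸).continuous.comp hG') 1
  refine ⟨w, hw0, fun x hx => ?_⟩
  have := (hw x).hasDerivWithinAt (s := s)
  rwa [hρe x hx] at this

/-- The pair (W, S) solves a single linear equation in 𝔸 × 𝔸. S is the candidate for the derivative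
of W when A moves in the direction B. -/
theorem exists_variationalSolution {A B : ℝ → 𝔸} {s : Set ℝ} (ρ : ℝ → ℝ) (hρ : Continuous ρ)
    (hρs : ∀ x, ρ x ∈ s) (hρe : ∀ x ∈ s, ρ x = x) (hA : ContinuousOn A s)
    (hB : ContinuousOn B s) :
    ∃ W S : ℝ → 𝔸, W 0 = 1 ∧ S 0 = 0 ∧ (∀ x ∈ s, HasDerivWithinAt W (A x * W x) s x) ∧
      ∀ x ∈ s, HasDerivWithinAt S (A x * S x + B x * W x) s x := by
  have hA' : Continuous (fun x => A (ρ x)) := hA.comp_continuous hρ hρs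
  have hB' : Continuous (fun x => B (ρ x)) := hB.comp_continuous hρ hρs
  have hmul := (ContinuousLinearMap.mul ℝ 𝔸).continuous
  obtain ⟨y, hy0, hy⟩ := exists_linearODE_solution (E := 𝔸 × 𝔸)
    (A := fun x =>
      (ContinuousLinearMap.inl ℝ 𝔸 𝔸).comp
        ((ContinuousLinearMap.mul ℝ 𝔸 (A (ρ x))).comp (ContinuousLinearMap.fst ℝ 𝔸 𝔸))
      + (ContinuousLinearMap.inr ℝ 𝔸 𝔸).comp
        ((ContinuousLinearMap.mul ℝ 𝔸 (A (ρ x))).comp (ContinuousLinearMap.snd ℝ 𝔸 𝔸)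
        + (ContinuousLinearMap.mul ℝ 𝔸 (B (ρ x))).comp (ContinuousLinearMap.fst ℝ 𝔸 𝔸)))
    ((continuous_const.clm_comp ((hmul.comp hA').clm_comp continuous_const)).add
      (continuous_const.clm_comp (((hmul.comp hA').clm_comp continuous_const).add
        ((hmul.comp hB').clm_comp continuous_const)))) (1, 0)
  refine ⟨fun x => (y x).1, fun x => (y x).2, by simp [hy0], by simp [hy0], fun x hx => ?_,
    fun x hx => ?_⟩
  · have := ((ContinuousLinearMap.fst ℝ 𝔸 𝔸).hasFDerivAt.comp_hasDerivAt x
      (hy x)).hasDerivWithinAt (s := s)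
    exact this.congr_deriv (by simp [hρe x hx])
  · have := ((ContinuousLinearMap.snd ℝ 𝔸 𝔸).hasFDerivAt.comp_hasDerivAt x
      (hy x)).hasDerivWithinAt (s := s)
    exact this.congr_deriv (by simp [hρe x hx])

end Algebra

/-! ### Analyticity in z, truncated Weyl vectors and their limit. -/

namespace NWave

variable {m : ℕ} {d : Fin m → ℝ} {ζ : ℝ → Matrix (Fin m) (Fin m) ℂ} {z : ℂ}

lemma continuousOn_coefficient {s : Set ℝ} (hζ : ContinuousOn ζ s) (z : ℂ) :
    ContinuousOn (fun x => (Complex.I * z) • diagMat d - ζ x) s :=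
  continuousOn_const.sub hζ

theorem exists_isFundamentalSolution (hζ : ContinuousOn ζ (Ici 0)) (z : ℂ) :
    ∃ w, IsFundamentalSolution d ζ (Ici 0) z w :=
  exists_fundamentalMatrix (max 0) (by fun_prop) (fun _ => mem_Ici.2 (le_max_left _ _))
    (fun _ hx => max_eq_right hx) (continuousOn_coefficient hζ z)

theorem IsFundamentalSolution.eqOn {w w' : ℝ → Matrix (Fin m) (Fin m) ℂ}
    (hζ : ContinuousOn ζ (Ici 0))
    (hw : IsFundamentalSolution d ζ (Ici 0) z w) (hw' : IsFundamentalSolution d ζ (Ici 0) z w') :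
    EqOn w w' (Ici 0) := by
  intro x hx
  obtain ⟨K, hK⟩ := (isCompact_Icc (a := 0) (b := x)).exists_bound_of_continuousOn
    ((continuousOn_coefficient (d := d) hζ z).mono Icc_subset_Ici_self)
  exact linearODE_solution_unique hK (hw.1.trans hw'.1.symm)
    (fun s hs => (hw.2 s hs.1).mono Icc_subset_Ici_self)
    (fun s hs => (hw'.2 s hs.1).mono Icc_subset_Ici_self) ⟨hx, le_rfl⟩

/-- Fundamental solutions are entire functions of the spectral parameter. -/
theorem differentiable_fundamentalSolution (hζ : ContinuousOn ζ (Ici 0))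
    {w : ℂ → ℝ → Matrix (Fin m) (Fin m) ℂ} (hw : ∀ z, IsFundamentalSolution d ζ (Ici 0) z (w z))
    {x : ℝ} (hx : 0 ≤ x) : Differentiable ℂ (fun z => w z x) := by
  intro z
  obtain ⟨W, S, hW0, hS0, hW, hS⟩ := exists_variationalSolution
    (B := fun _ => Complex.I • diagMat d) (max 0)
    (by fun_prop : Continuous (max (0 : ℝ)))
    (fun _ => mem_Ici.2 (le_max_left _ _)) (fun _ hx => max_eq_right hx)
    (continuousOn_coefficient (d := d) hζ z) continuousOn_const
  have hWw : EqOn W (w z) (Ici 0) := IsFundamentalSolution.eqOn hζ ⟨hW0, hW⟩ (hw z)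
  obtain ⟨K, hK⟩ := (isCompact_Icc (a := 0) (b := x)).exists_bound_of_continuousOn
    ((continuousOn_coefficient (d := d) hζ z).mono Icc_subset_Ici_self)
  have := hasDerivWithinAt_solution_of_param (P := univ) (mem_univ z)
    (A := fun z x => (Complex.I * z) • diagMat d - ζ x) (W := w)
    (B := fun _ => Complex.I • diagMat d) (S := S) hx
    (K := max K ‖Complex.I • diagMat d‖) (fun s hs => (hK s hs).trans (le_max_left _ _))
    (fun s hs => le_max_right _ _) (fun q _ => (hw q).1.trans (hw z).1.symm) hS0
    -- The coefficient is affine in z, so its linearization is exact.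
    (fun ε hε => .of_forall fun q s hs => by
      rw [show (Complex.I * q) • diagMat d - ζ s - ((Complex.I * z) • diagMat d - ζ s)
        - (q - z) • Complex.I • diagMat d = 0 by module, norm_zero]
      positivity)
    (fun q _ s hs => ((hw q).2 s hs.1).mono Icc_subset_Ici_self)
    (fun s hs => by
      have := (hS s hs.1).mono (Icc_subset_Ici_self : Icc 0 x ⊆ Ici 0)
      rwa [hWw hs.1] at this)
  exact (hasDerivWithinAt_univ.1 this).differentiableAt

/-- The coordinate projection onto the indices `< k`. -/
noncomputable def upperProj (k : Fin m) : Matrix (Fin m) (Fin m) ℂ :=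
  Matrix.diagonal fun i => if i < k then 1 else 0

/-- The upper left block of `A`, completed by the identity. -/
noncomputable def upperCorner (k : Fin m) (A : Matrix (Fin m) (Fin m) ℂ) :
    Matrix (Fin m) (Fin m) ℂ :=
  upperProj k * A * upperProj k + (1 - upperProj k)

/-- The vector `f` with lower part `e_k` such that the upper part of `A f` vanishes. -/
noncomputable def truncatedWeyl (k : Fin m) (A : Matrix (Fin m) (Fin m) ℂ) : Fin m → ℂ :=
  Pi.single k 1 - (upperCorner k A)⁻¹ *ᵥ (upperProj k *ᵥ (A *ᵥ Pi.single k 1))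

lemma upperProj_mulVec (k : Fin m) (v : Fin m → ℂ) (i : Fin m) :
    (upperProj k *ᵥ v) i = if i < k then v i else 0 := by
  simp [upperProj, Matrix.mulVec_diagonal]

lemma upperProj_mulVec_of_lower_eq_zero {k : Fin m} {v : Fin m → ℂ}
    (hv : ∀ i, k ≤ i → v i = 0) : upperProj k *ᵥ v = v := by
  funext i
  rw [upperProj_mulVec]
  split_ifs with h
  · rfl
  · exact (hv i (not_lt.1 h)).symm

lemma upperCorner_mulVec (k : Fin m) (A : Matrix (Fin m) (Fin m) ℂ) (v : Fin m → ℂ) :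
    upperCorner k A *ᵥ v
      = upperProj k *ᵥ (A *ᵥ (upperProj k *ᵥ v)) + (v - upperProj k *ᵥ v) := by
  simp [upperCorner, Matrix.add_mulVec, Matrix.sub_mulVec, Matrix.mulVec_mulVec, Matrix.mul_assoc]

lemma upperCorner_mulVec_lower {k : Fin m} (A : Matrix (Fin m) (Fin m) ℂ) (v : Fin m → ℂ)
    {i : Fin m} (hi : k ≤ i) : (upperCorner k A *ᵥ v) i = v i := by
  rw [upperCorner_mulVec]
  simp only [Pi.add_apply, Pi.sub_apply, upperProj_mulVec, if_neg (not_lt.2 hi), zero_add,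
    sub_zero]

lemma upperCorner_mulVec_upper {k : Fin m} (A : Matrix (Fin m) (Fin m) ℂ) {v : Fin m → ℂ}
    (hv : ∀ i, k ≤ i → v i = 0) {i : Fin m} (hi : i < k) :
    (upperCorner k A *ᵥ v) i = (A *ᵥ v) i := by
  rw [upperCorner_mulVec, upperProj_mulVec_of_lower_eq_zero hv]
  simp only [Pi.add_apply, upperProj_mulVec, if_pos hi, sub_self,
    Pi.zero_apply, add_zero]

section Truncated

variable {k : Fin m} {A : Matrix (Fin m) (Fin m) ℂ}

lemma upperCorner_mulVec_correction (hA : IsUnit (upperCorner k A)) :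
    upperCorner k A *ᵥ ((upperCorner k A)⁻¹ *ᵥ (upperProj k *ᵥ (A *ᵥ Pi.single k 1)))
      = upperProj k *ᵥ (A *ᵥ Pi.single k 1) := by
  rw [Matrix.mulVec_mulVec, Matrix.mul_nonsing_inv _ ((Matrix.isUnit_iff_isUnit_det _).1 hA),
    Matrix.one_mulVec]

lemma correction_lower (hA : IsUnit (upperCorner k A)) {i : Fin m} (hi : k ≤ i) :
    ((upperCorner k A)⁻¹ *ᵥ (upperProj k *ᵥ (A *ᵥ Pi.single k 1))) i = 0 := by
  have h := upperCorner_mulVec_lower A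
    ((upperCorner k A)⁻¹ *ᵥ (upperProj k *ᵥ (A *ᵥ Pi.single k 1))) hi
  rw [upperCorner_mulVec_correction hA, upperProj_mulVec, if_neg (not_lt.2 hi)] at h
  exact h.symm

lemma truncatedWeyl_lower (hA : IsUnit (upperCorner k A)) {i : Fin m} (hi : k ≤ i) :
    truncatedWeyl k A i = Pi.single (M := fun _ => ℂ) k 1 i := by
  rw [truncatedWeyl, Pi.sub_apply, correction_lower hA hi, sub_zero]

lemma mulVec_truncatedWeyl_upper (hA : IsUnit (upperCorner k A)) {i : Fin m} (hi : i < k) :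
    (A *ᵥ truncatedWeyl k A) i = 0 := by
  rw [truncatedWeyl, Matrix.mulVec_sub, Pi.sub_apply,
    ← upperCorner_mulVec_upper A
      (v := (upperCorner k A)⁻¹ *ᵥ (upperProj k *ᵥ (A *ᵥ Pi.single k 1)))
      (fun _ hj => correction_lower hA hj) hi,
    upperCorner_mulVec_correction hA, upperProj_mulVec, if_pos hi, sub_self]

end Truncated

/-- A kernel vector v has only upper coordinates, while w(l) v has only lower ones. So the form is
nonpositive at l, hence at 0, where it equals ‖v‖². -/
lemma isUnit_upperCorner {k : Fin m} {c g M₀ : ℝ} (hsep : IsSeparated d k c g) (hz : z.im ≤ 0)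
    (hε : M₀ ≤ -z.im * g) (hζ : ∀ x, 0 ≤ x → ‖ζ x‖ ≤ M₀)
    {w : ℝ → Matrix (Fin m) (Fin m) ℂ} (hw : IsFundamentalSolution d ζ (Ici 0) z w) {l : ℝ}
    (hl : 0 ≤ l) : IsUnit (upperCorner k (w l)) := by
  rw [← Matrix.mulVec_injective_iff_isUnit]
  refine (injective_iff_map_eq_zero (upperCorner k (w l)).mulVecLin).2 fun v hv => ?_
  rw [Matrix.mulVecLin_apply] at hv
  have hlow : ∀ i, k ≤ i → v i = 0 := fun i hi => by
    rw [← upperCorner_mulVec_lower (w l) v hi, hv, Pi.zero_apply]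
  have hu := hw.isVectorSolution (WithLp.toLp 2 v)
  have hul : coneForm k (Matrix.toEuclideanCLM (𝕜 := ℂ) (w l) (WithLp.toLp 2 v)) ≤ 0 := by
    rw [coneForm_of_upper_eq_zero]
    · nlinarith [norm_nonneg (Matrix.toEuclideanCLM (𝕜 := ℂ) (w l) (WithLp.toLp 2 v))]
    · intro i hi
      have := upperCorner_mulVec_upper (w l) hlow hi
      rw [hv] at this
      exact this.symm
  have h0 := coneForm_nonpos_of_le hsep hz hε hζ hu le_rfl hl hul
  rw [hw.1, map_one, one_apply_eq_self, coneForm_of_lower_eq_zero hlow] at h0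
  have : WithLp.toLp 2 v = 0 := by
    rw [← norm_eq_zero]
    exact pow_eq_zero_iff two_ne_zero |>.1 (le_antisymm h0 (sq_nonneg _))
  exact congrArg WithLp.ofLp this

/-- Because `upperCorner` is a full m × m matrix, inversion in the matrix algebra applies directly.
-/
lemma differentiableAt_truncatedWeyl {k : Fin m} {w : ℂ → Matrix (Fin m) (Fin m) ℂ}
    (hw : DifferentiableAt ℂ w z) (hu : IsUnit (upperCorner k (w z))) (i : Fin m) :
    DifferentiableAt ℂ (fun z => truncatedWeyl k (w z) i) z := by
  have hQ : DifferentiableAt ℂ (fun z => upperCorner k (w z)) z := by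
    unfold upperCorner
    exact (((differentiableAt_const _).mul hw).mul (differentiableAt_const _)).add_const _
  have hQinv : DifferentiableAt ℂ (fun z => (upperCorner k (w z))⁻¹) z := by
    simp only [Matrix.nonsing_inv_eq_ringInverse]
    exact (differentiableAt_inverse hu).comp z hQ
  have hprod : DifferentiableAt ℂ
      (fun z => (upperCorner k (w z))⁻¹ * upperProj k * w z) z :=
    (hQinv.mul (differentiableAt_const _)).mul hw
  have hentry : DifferentiableAt ℂ
      (fun z => ((upperCorner k (w z))⁻¹ * upperProj k * w z) i k) z :=
    (LinearMap.toContinuousLinearMap (Matrix.entryLinearMap ℂ ℂ i k)).differentiableAt.comp z hprod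
  have : (fun z => truncatedWeyl k (w z) i)
      = fun z => Pi.single (M := fun _ => ℂ) k 1 i
        - ((upperCorner k (w z))⁻¹ * upperProj k * w z) i k := by
    funext z
    rw [truncatedWeyl, Pi.sub_apply, Matrix.mulVec_mulVec, Matrix.mulVec_mulVec,
      Matrix.mulVec_single_one, Matrix.col_apply]
  rw [this]
  exact (differentiableAt_const _).sub hentry

/-- The lower part e_k contributes 1 and the upper part only subtracts. This makes the right-hand
side of `mul_norm_sub_sq_le` a constant independent of z and l. -/
lemma neg_coneForm_le_one {k : Fin m} {u : EuclideanSpace ℂ (Fin m)}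
    (hu : ∀ i, k ≤ i → u i = Pi.single (M := fun _ => ℂ) k 1 i) : -coneForm k u ≤ 1 := by
  have : ∑ i, (Pi.single (M := fun _ => ℝ) k 1 i) = 1 := by simp
  rw [← this, coneForm, weightedSq, ← Finset.sum_neg_distrib]
  refine Finset.sum_le_sum fun i _ => ?_
  split_ifs with h
  · rw [Pi.single_eq_of_ne h.ne]
    nlinarith [norm_nonneg (u i)]
  · rw [hu i (not_lt.1 h)]
    by_cases hik : i = k
    · subst hik; simp
    · simp [Pi.single_eq_of_ne hik]

/-- A bound on the distance between two vectors with lower part `e_k` whose solutions lie in the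
cone at `l`. -/
lemma mul_norm_sub_sq_le_two {k : Fin m} {c g M₀ : ℝ} (hsep : IsSeparated d k c g)
    (hz : z.im ≤ 0) (hε : M₀ ≤ -z.im * g) (hζ : ∀ x, 0 ≤ x → ‖ζ x‖ ≤ M₀)
    {w : ℝ → Matrix (Fin m) (Fin m) ℂ} (hw : IsFundamentalSolution d ζ (Ici 0) z w)
    {f f' : EuclideanSpace ℂ (Fin m)}
    (hf : ∀ i, k ≤ i → f i = Pi.single (M := fun _ => ℂ) k 1 i)
    (hf' : ∀ i, k ≤ i → f' i = Pi.single (M := fun _ => ℂ) k 1 i) {l : ℝ} (hl : 0 ≤ l)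
    (hfl : coneForm k (Matrix.toEuclideanCLM (𝕜 := ℂ) (w l) f) ≤ 0)
    (hfl' : coneForm k (Matrix.toEuclideanCLM (𝕜 := ℂ) (w l) f') ≤ 0) :
    (-z.im * g - M₀) * l * ‖f - f'‖ ^ 2 ≤ 2 := by
  have h0 : ∀ f, Matrix.toEuclideanCLM (𝕜 := ℂ) (w 0) f = f := fun f => by
    rw [hw.1, map_one, one_apply_eq_self]
  have h := mul_norm_sub_sq_le hsep hz hε hζ (hw.isVectorSolution f) (hw.isVectorSolution f')
    (fun i hi => by rw [h0, h0, hf i hi, hf' i hi]) hl hfl hfl'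
  rw [h0, h0] at h
  linarith [neg_coneForm_le_one hf, neg_coneForm_le_one hf']

section Limit

variable {k : Fin m} {c g M₀ : ℝ} {w : ℝ → Matrix (Fin m) (Fin m) ℂ}

lemma coneForm_truncatedWeyl_nonpos (hsep : IsSeparated d k c g) (hz : z.im ≤ 0)
    (hε : M₀ ≤ -z.im * g) (hζ : ∀ x, 0 ≤ x → ‖ζ x‖ ≤ M₀)
    (hw : IsFundamentalSolution d ζ (Ici 0) z w) {x l : ℝ} (hx : 0 ≤ x) (hxl : x ≤ l) :
    coneForm k (Matrix.toEuclideanCLM (𝕜 := ℂ) (w x)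
      (WithLp.toLp 2 (truncatedWeyl k (w l)))) ≤ 0 := by
  refine coneForm_nonpos_of_le hsep hz hε hζ (hw.isVectorSolution _) hx hxl ?_
  rw [coneForm_of_upper_eq_zero]
  · nlinarith [norm_nonneg (Matrix.toEuclideanCLM (𝕜 := ℂ) (w l)
      (WithLp.toLp 2 (truncatedWeyl k (w l))))]
  · exact fun i hi => mulVec_truncatedWeyl_upper
      (isUnit_upperCorner hsep hz hε hζ hw (hx.trans hxl)) hi

/-- The limit of the truncated Weyl vectors. -/
theorem exists_weylVector (hsep : IsSeparated d k c g) (hz : z.im ≤ 0)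
    (hε : M₀ < -z.im * g) (hζ : ∀ x, 0 ≤ x → ‖ζ x‖ ≤ M₀)
    (hw : IsFundamentalSolution d ζ (Ici 0) z w) :
    ∃ f : EuclideanSpace ℂ (Fin m), (∀ i, k ≤ i → f i = Pi.single (M := fun _ => ℂ) k 1 i) ∧
      ∀ x, 0 ≤ x → coneForm k (Matrix.toEuclideanCLM (𝕜 := ℂ) (w x) f) ≤ 0 := by
  set F : ℕ → EuclideanSpace ℂ (Fin m) := fun n => WithLp.toLp 2 (truncatedWeyl k (w n)) with hF
  have hε' : 0 < -z.im * g - M₀ := by linarith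
  have hlow : ∀ n i, k ≤ i → F n i = Pi.single (M := fun _ => ℂ) k 1 i := fun n i hi =>
    truncatedWeyl_lower (isUnit_upperCorner hsep hz hε.le hζ hw (Nat.cast_nonneg n)) hi
  have hcone : ∀ (n : ℕ) (x : ℝ), 0 ≤ x → x ≤ (n : ℝ) →
      coneForm k (Matrix.toEuclideanCLM (𝕜 := ℂ) (w x) (F n)) ≤ 0 := fun n x hx hxn =>
    coneForm_truncatedWeyl_nonpos hsep hz hε.le hζ hw hx hxn
  -- The shift keeps the common length N + 1 positive, so that the estimate can be divided by it
  -- also for N = 0.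
  have hcau : CauchySeq fun n => F (n + 1) := by
    refine cauchySeq_of_le_tendsto_0
      (fun n : ℕ => √(2 / (-z.im * g - M₀) * (1 / ((n : ℝ) + 1)))) (fun n n' N hn hn' => ?_) ?_
    · rw [dist_eq_norm]
      refine Real.le_sqrt_of_sq_le ?_
      have h1 : ∀ n, N ≤ n → ((N : ℝ) + 1) ≤ ((n + 1 : ℕ) : ℝ) := fun n hn => by
        exact_mod_cast Nat.succ_le_succ hn
      have h := mul_norm_sub_sq_le_two hsep hz hε.le hζ hw (hlow (n + 1)) (hlow (n' + 1))
        (l := N + 1) (by positivity) (hcone _ _ (by positivity) (h1 n hn))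
        (hcone _ _ (by positivity) (h1 n' hn'))
      rw [div_mul_div_comm, mul_one, le_div_iff₀ (by positivity)]
      linarith
    · have := (tendsto_one_div_add_atTop_nhds_zero_nat (𝕜 := ℝ)).const_mul (2 / (-z.im * g - M₀))
      rw [mul_zero] at this
      simpa using this.sqrt
  obtain ⟨f, hf⟩ := cauchySeq_tendsto_of_complete hcau
  refine ⟨f, fun i hi => ?_, fun x hx => ?_⟩
  · have h1 : Tendsto (fun n => F (n + 1) i) atTop (𝓝 (f i)) :=
      ((EuclideanSpace.proj (𝕜 := ℂ) i).continuous.tendsto f).comp hf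
    refine tendsto_nhds_unique h1 ?_
    simp only [hlow _ i hi]
    exact tendsto_const_nhds
  · have h1 : Tendsto (fun n => coneForm k (Matrix.toEuclideanCLM (𝕜 := ℂ) (w x) (F (n + 1))))
        atTop (𝓝 (coneForm k (Matrix.toEuclideanCLM (𝕜 := ℂ) (w x) f))) :=
      (((continuous_weightedSq _).comp (ContinuousLinearMap.continuous _)).tendsto f).comp hf
    refine le_of_tendsto h1 ?_
    filter_upwards [eventually_ge_atTop ⌈x⌉₊] with n hn
    refine hcone _ x hx ((Nat.le_ceil x).trans ?_)
    exact_mod_cast hn.trans n.le_succ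

end Limit

lemma isOpen_lowerHalfPlane (M : ℝ) : IsOpen (lowerHalfPlane M) :=
  isOpen_lt Complex.continuous_im continuous_const

/-- A family of vectors with lower part `e_k` whose solutions stay in the cone is holomorphic. -/
theorem differentiableOn_weylVector {k : Fin m} {c g M₀ M : ℝ} (hsep : IsSeparated d k c g)
    (hM : 0 ≤ M) (hg : 0 < g) (hε : M₀ < M * g) (hcont : ContinuousOn ζ (Ici 0))
    (hζ : ∀ x, 0 ≤ x → ‖ζ x‖ ≤ M₀)
    {w : ℂ → ℝ → Matrix (Fin m) (Fin m) ℂ} (hw : ∀ z, IsFundamentalSolution d ζ (Ici 0) z (w z))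
    {f : ℂ → EuclideanSpace ℂ (Fin m)}
    (hf : ∀ z ∈ lowerHalfPlane M, ∀ i, k ≤ i → f z i = Pi.single (M := fun _ => ℂ) k 1 i)
    (hfcone : ∀ z ∈ lowerHalfPlane M, ∀ x, 0 ≤ x →
      coneForm k (Matrix.toEuclideanCLM (𝕜 := ℂ) (w z x) (f z)) ≤ 0) (i : Fin m) :
    DifferentiableOn ℂ (fun z => f z i) (lowerHalfPlane M) := by
  have hz0 : ∀ z ∈ lowerHalfPlane M, z.im ≤ 0 := fun z hz => by
    have : z.im < -M := hz
    linarith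
  have hzε : ∀ z ∈ lowerHalfPlane M, M * g - M₀ ≤ -z.im * g - M₀ := fun z hz => by
    have : z.im < -M := hz
    nlinarith
  have hε' : 0 < M * g - M₀ := by linarith
  have hunit : ∀ z ∈ lowerHalfPlane M, ∀ n : ℕ, IsUnit (upperCorner k (w z n)) := fun z hz n =>
    isUnit_upperCorner hsep (hz0 z hz) (by linarith [hzε z hz]) hζ (hw z) (Nat.cast_nonneg n)
  refine TendstoLocallyUniformlyOn.differentiableOn (φ := atTop)
    (F := fun (n : ℕ) z => truncatedWeyl k (w z n) i) ?_ (.of_forall fun n z hz =>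
      (differentiableAt_truncatedWeyl
        (differentiable_fundamentalSolution hcont hw (Nat.cast_nonneg n) z)
        (hunit z hz n) i).differentiableWithinAt) (isOpen_lowerHalfPlane M)
  -- The convergence is uniform on the whole half-plane because -Im z * g - M₀ is bounded below by M
  -- * g - M₀ > 0.
  refine TendstoUniformlyOn.tendstoLocallyUniformlyOn ?_
  rw [Metric.tendstoUniformlyOn_iff]
  intro ε hεpos
  obtain ⟨N, hN⟩ := exists_nat_gt (2 / ((M * g - M₀) * ε ^ 2))
  filter_upwards [eventually_ge_atTop (max N 1)] with n hn z hz
  have hnN : (N : ℝ) ≤ n := by exact_mod_cast (le_max_left _ _).trans hn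
  have hn0 : (0 : ℝ) < n := by exact_mod_cast lt_of_lt_of_le one_pos ((le_max_right _ _).trans hn)
  have h := mul_norm_sub_sq_le_two hsep (hz0 z hz) (by linarith [hzε z hz]) hζ (hw z) (hf z hz)
    (f' := WithLp.toLp 2 (truncatedWeyl k (w z n)))
    (fun i hi => truncatedWeyl_lower (hunit z hz n) hi) (Nat.cast_nonneg n)
    (hfcone z hz n (Nat.cast_nonneg n))
    (coneForm_truncatedWeyl_nonpos hsep (hz0 z hz) (by linarith [hzε z hz]) hζ (hw z)
      (Nat.cast_nonneg n) le_rfl)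
  set v := f z - WithLp.toLp 2 (truncatedWeyl k (w z n)) with hv
  have hvi : dist (f z i) (truncatedWeyl k (w z n) i) ≤ ‖v‖ := by
    rw [dist_eq_norm]
    exact PiLp.norm_apply_le v i
  refine hvi.trans_lt (lt_of_pow_lt_pow_left₀ 2 hεpos.le ?_)
  have h1 := hN.trans_le hnN
  rw [div_lt_iff₀ (by positivity)] at h1
  have h2 : (M * g - M₀) * n * ‖v‖ ^ 2 ≤ 2 :=
    (mul_le_mul_of_nonneg_right (mul_le_mul_of_nonneg_right (hzε z hz) hn0.le)
      (sq_nonneg _)).trans h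
  refine lt_of_mul_lt_mul_left (a := (M * g - M₀) * n) ?_ (by positivity)
  linarith

/-! ### The Weyl integral: existence and uniqueness of the Weyl function. -/

/-- The columns of `B` as vectors of the Euclidean space. -/
noncomputable def colVec (B : Matrix (Fin m) (Fin m) ℂ) (k : Fin m) : EuclideanSpace ℂ (Fin m) :=
  WithLp.toLp 2 (B.col k)

@[simp] lemma colVec_apply (B : Matrix (Fin m) (Fin m) ℂ) (k i : Fin m) : colVec B k i = B i k :=
  rfl

lemma toEuclideanCLM_colVec (A B : Matrix (Fin m) (Fin m) ℂ) (k : Fin m) :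
    Matrix.toEuclideanCLM (𝕜 := ℂ) A (colVec B k) = colVec (A * B) k := by
  ext i
  simp [colVec, Matrix.mulVec, Matrix.mul_apply, dotProduct]

lemma exp_diagMat (c : ℂ) (d : Fin m → ℝ) :
    NormedSpace.exp (c • diagMat d) = Matrix.diagonal fun i => Complex.exp (c * d i) := by
  have h : c • diagMat d = Matrix.diagonal fun i => c * d i := by
    ext i j
    by_cases hij : i = j
    · subst hij; simp [diagMat]
    · simp [diagMat, hij]
  rw [h, Matrix.exp_diagonal, Pi.exp_def]
  simp only [Complex.exp_eq_exp_ℂ]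

/-- The integrand of the Weyl condition. -/
noncomputable def weylIntegrand (d : Fin m → ℝ) (z : ℂ) (r : ℝ)
    (φ : Matrix (Fin m) (Fin m) ℂ) (w : ℝ → Matrix (Fin m) (Fin m) ℂ) (x : ℝ) :
    Matrix (Fin m) (Fin m) ℂ :=
  NormedSpace.exp ((Complex.I * (starRingEnd ℂ) z * (x : ℂ)) • diagMat d)
    * φᴴ * (w x)ᴴ * w x * φ
    * NormedSpace.exp (-((x : ℂ) • ((Complex.I * z) • diagMat d
        + (r : ℂ) • (1 : Matrix (Fin m) (Fin m) ℂ))))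

lemma weylIntegrand_apply (r : ℝ) (φ : Matrix (Fin m) (Fin m) ℂ)
    (w : ℝ → Matrix (Fin m) (Fin m) ℂ) (x : ℝ) (i j : Fin m) :
    weylIntegrand d z r φ w x i j
      = Complex.exp (Complex.I * (starRingEnd ℂ) z * x * d i)
        * inner ℂ (colVec (w x * φ) i) (colVec (w x * φ) j)
        * Complex.exp (-(x * (Complex.I * z * d j + r))) := by
  have h : -((x : ℂ) • ((Complex.I * z) • diagMat d
      + (r : ℂ) • (1 : Matrix (Fin m) (Fin m) ℂ)))
      = Matrix.diagonal fun i => -((x : ℂ) * (Complex.I * z * d i + r)) := by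
    ext i j
    by_cases hij : i = j
    · subst hij
      simp only [Matrix.neg_apply, Matrix.smul_apply, Matrix.add_apply, diagMat,
        Matrix.diagonal_apply_eq, Matrix.one_apply_eq, smul_eq_mul, mul_one]
    · simp [diagMat, hij]
  rw [weylIntegrand, exp_diagMat, h, Matrix.exp_diagonal, Pi.exp_def]
  simp only [← Complex.exp_eq_exp_ℂ]
  rw [Matrix.mul_diagonal]
  simp only [Matrix.mul_assoc]
  rw [Matrix.diagonal_mul]
  congr 2
  rw [← Matrix.mul_assoc, ← Matrix.conjTranspose_mul, Matrix.mul_apply, PiLp.inner_apply]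
  refine Finset.sum_congr rfl fun l _ => ?_
  simp [Matrix.conjTranspose_apply, mul_comm]

lemma norm_weylIntegrand_apply (r : ℝ) (φ : Matrix (Fin m) (Fin m) ℂ)
    (w : ℝ → Matrix (Fin m) (Fin m) ℂ) (x : ℝ) (i j : Fin m) :
    ‖weylIntegrand d z r φ w x i j‖
      = Real.exp (-(-z.im * d i * x)) * ‖inner ℂ (colVec (w x * φ) i) (colVec (w x * φ) j)‖
        * Real.exp (-(-z.im * d j * x + r * x)) := by
  rw [weylIntegrand_apply, norm_mul, norm_mul, Complex.norm_exp, Complex.norm_exp]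
  congr 3
  · simp
    ring
  · simp
    ring

lemma integrableOn_matrix {F : ℝ → Matrix (Fin m) (Fin m) ℂ} {s : Set ℝ}
    (h : ∀ i j, MeasureTheory.IntegrableOn (fun x => F x i j) s) :
    MeasureTheory.IntegrableOn F s := by
  have : F = fun x => ∑ i, ∑ j, F x i j • Matrix.single i j (1 : ℂ) := by
    funext x
    conv_lhs => rw [Matrix.matrix_eq_sum_single (F x)]
    simp
  rw [this]
  exact MeasureTheory.integrable_finsetSum _ fun i _ =>
    MeasureTheory.integrable_finsetSum _ fun j _ => (h i j).smul_const _

lemma IsDecaying.mono {κ κ' : ℝ} {u : ℝ → EuclideanSpace ℂ (Fin m)} (hu : IsDecaying κ u)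
    (hc : ContinuousOn u (Ici 0)) (h : κ ≤ κ') : IsDecaying κ' u := by
  refine MeasureTheory.MemLp.of_le hu ?_ ?_
  · exact ((by fun_prop : Continuous fun x : ℝ => Real.exp (-(κ' * x))).continuousOn.smul
      (hc.mono Ioi_subset_Ici_self)).aestronglyMeasurable measurableSet_Ioi
  · refine (MeasureTheory.ae_restrict_iff' measurableSet_Ioi).2 (.of_forall fun x hx => ?_)
    rw [norm_smul, norm_smul]
    refine mul_le_mul_of_nonneg_right ?_ (norm_nonneg _)
    rw [Real.norm_of_nonneg (Real.exp_pos _).le, Real.norm_of_nonneg (Real.exp_pos _).le,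
      Real.exp_le_exp]
    have : 0 < x := hx
    nlinarith

/-- The columns of a Weyl function give solutions of restricted growth. -/
lemma isDecaying_of_integrableOn_weylIntegrand {r : ℝ} {φ : Matrix (Fin m) (Fin m) ℂ}
    {w : ℝ → Matrix (Fin m) (Fin m) ℂ} (hw : IsFundamentalSolution d ζ (Ici 0) z w)
    (h : MeasureTheory.IntegrableOn (weylIntegrand d z r φ w) (Ioi 0)) (k : Fin m) :
    IsDecaying (-z.im * d k + r / 2)
      (fun x => Matrix.toEuclideanCLM (𝕜 := ℂ) (w x) (colVec φ k)) := by
  rw [isDecaying_iff (hw.isVectorSolution _).continuousOn]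
  have h1 : MeasureTheory.IntegrableOn (fun x => ‖weylIntegrand d z r φ w x k k‖) (Ioi 0) :=
    ((LinearMap.toContinuousLinearMap (Matrix.entryLinearMap ℂ ℂ k k)).integrable_comp h).norm
  refine h1.congr (.of_forall fun x => ?_)
  beta_reduce
  rw [norm_weylIntegrand_apply, inner_self_eq_norm_sq_to_K, toEuclideanCLM_colVec, mul_right_comm,
    ← Real.exp_add]
  congr 1
  · congr 1; ring
  · simp

/-- Decaying solutions are determined by the lower part of the initial value. -/
lemma eq_of_isDecaying {k : Fin m} {c g M₀ : ℝ} (hsep : IsSeparated d k c g) (hz : z.im ≤ 0)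
    (hε : M₀ ≤ -z.im * g) (hζ : ∀ x, 0 ≤ x → ‖ζ x‖ ≤ M₀)
    {w : ℝ → Matrix (Fin m) (Fin m) ℂ} (hw : IsFundamentalSolution d ζ (Ici 0) z w)
    {f f' : EuclideanSpace ℂ (Fin m)} (hff' : ∀ i, k ≤ i → f i = f' i)
    (hf : IsDecaying (-z.im * c) (fun x => Matrix.toEuclideanCLM (𝕜 := ℂ) (w x) f))
    (hf' : IsDecaying (-z.im * c) (fun x => Matrix.toEuclideanCLM (𝕜 := ℂ) (w x) f')) :
    f = f' := by
  have hdec : IsDecaying (-z.im * c) (fun x => Matrix.toEuclideanCLM (𝕜 := ℂ) (w x) (f - f')) := by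
    have := MeasureTheory.MemLp.sub hf hf'
    refine this.ae_eq (.of_forall fun x => ?_)
    simp [smul_sub]
  have h := hdec.coneForm_nonpos hsep hz hε hζ (hw.isVectorSolution _) le_rfl
  rw [hw.1, map_one, one_apply_eq_self, coneForm_of_lower_eq_zero
    (fun i hi => by rw [PiLp.sub_apply, hff' i hi, sub_self])] at h
  exact sub_eq_zero.1 (norm_eq_zero.1 (pow_eq_zero_iff two_ne_zero |>.1
    (le_antisymm h (sq_nonneg _))))

/-- The columns of `φ` have the triangular normalization and start solutions in the cones. -/
def IsConeNormalized (d : Fin m → ℝ) (ζ : ℝ → Matrix (Fin m) (Fin m) ℂ) (z : ℂ)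
    (φ : Matrix (Fin m) (Fin m) ℂ) : Prop :=
  (∀ i j, (i = j → φ i j = 1) ∧ (j < i → φ i j = 0)) ∧
  ∀ w, IsFundamentalSolution d ζ (Ici 0) z w → ∀ k x, 0 ≤ x →
    coneForm k (Matrix.toEuclideanCLM (𝕜 := ℂ) (w x) (colVec φ k)) ≤ 0

/-- Every jump of `d` is large enough for the bound `M₀` on `{Im z < -M}`. -/
def HasGaps (d : Fin m → ℝ) (M₀ M : ℝ) : Prop :=
  ∀ k, ∃ c g, 0 < g ∧ IsSeparated d k c g ∧ M₀ < M * g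

/-- By the cone bound, column k grows at most like exp((-Im z) d_k x + 2 M₀ x). The outer
exponentials cancel the d-dependent factors in every entry, and r = 4 M₀ + 1 leaves exp(-x). -/
lemma integrableOn_weylIntegrand {M₀ : ℝ} (hd : Antitone d) (hz : z.im ≤ 0) (hM₀ : 0 ≤ M₀)
    (hζ : ∀ x, 0 ≤ x → ‖ζ x‖ ≤ M₀) {φ : Matrix (Fin m) (Fin m) ℂ}
    (hφ : IsConeNormalized d ζ z φ) {w : ℝ → Matrix (Fin m) (Fin m) ℂ}
    (hw : IsFundamentalSolution d ζ (Ici 0) z w) :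
    MeasureTheory.IntegrableOn (weylIntegrand d z (4 * M₀ + 1) φ w) (Ioi 0) := by
  refine integrableOn_matrix fun i j => ?_
  set C := ∑ k, 2 * ‖colVec φ k‖ ^ 2 with hC
  have hC0 : 0 ≤ C := Finset.sum_nonneg fun k _ => by positivity
  have hcol : ∀ k x, 0 ≤ x →
      ‖colVec (w x * φ) k‖ ≤ √C * Real.exp (-z.im * d k * x + 2 * M₀ * x) := by
    intro k x hx
    have h := norm_sq_le_of_coneForm_nonpos hd hz hM₀ hζ (hw.isVectorSolution (colVec φ k))
      (fun x hx => hφ.2 w hw k x hx) hx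
    rw [hw.1, map_one, one_apply_eq_self, toEuclideanCLM_colVec] at h
    refine le_of_sq_le_sq ?_ (by positivity)
    rw [mul_pow, Real.sq_sqrt hC0, ← Real.exp_nat_mul]
    refine h.trans ?_
    have h1 : 2 * ‖colVec φ k‖ ^ 2 ≤ C :=
      Finset.single_le_sum (f := fun k => 2 * ‖colVec φ k‖ ^ 2) (fun k _ => by positivity)
        (Finset.mem_univ k)
    have h2 : 2 * (-z.im) * d k * x + 4 * M₀ * x
        = (2 : ℕ) * (-z.im * d k * x + 2 * M₀ * x) := by push_cast; ring
    rw [h2]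
    exact mul_le_mul_of_nonneg_right h1 (Real.exp_pos _).le
  have hcont : ∀ k, ContinuousOn (fun x => colVec (w x * φ) k) (Ici 0) := fun k => by
    have := (hw.isVectorSolution (colVec φ k)).continuousOn
    simpa only [toEuclideanCLM_colVec] using this
  have hmeas : MeasureTheory.AEStronglyMeasurable
      (fun x => weylIntegrand d z (4 * M₀ + 1) φ w x i j)
      (MeasureTheory.volume.restrict (Ioi 0)) := by
    refine ContinuousOn.aestronglyMeasurable ?_ measurableSet_Ioi
    refine ContinuousOn.mono ?_ Ioi_subset_Ici_self
    simp only [weylIntegrand_apply]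
    exact ((by fun_prop : Continuous fun x : ℝ =>
      Complex.exp (Complex.I * (starRingEnd ℂ) z * x * d i)).continuousOn.mul
        (((hcont i).inner (𝕜 := ℂ) (hcont j)))).mul (by fun_prop : Continuous fun x : ℝ =>
      Complex.exp (-(x * (Complex.I * z * d j + ((4 * M₀ + 1 : ℝ) : ℂ))))).continuousOn
  refine MeasureTheory.Integrable.mono'
    ((integrableOn_exp_mul_Ioi (show (-1 : ℝ) < 0 by norm_num) 0).const_mul C) hmeas
    ((MeasureTheory.ae_restrict_iff' measurableSet_Ioi).2 (.of_forall fun x hx => ?_))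
  have hx : 0 ≤ x := le_of_lt hx
  rw [norm_weylIntegrand_apply]
  calc _ ≤ Real.exp (-(-z.im * d i * x))
        * ((√C * Real.exp (-z.im * d i * x + 2 * M₀ * x))
          * (√C * Real.exp (-z.im * d j * x + 2 * M₀ * x)))
        * Real.exp (-(-z.im * d j * x + (4 * M₀ + 1) * x)) := by
        refine mul_le_mul_of_nonneg_right (mul_le_mul_of_nonneg_left ?_ (Real.exp_pos _).le)
          (Real.exp_pos _).le
        exact (norm_inner_le_norm _ _).trans
          (mul_le_mul (hcol i x hx) (hcol j x hx) (norm_nonneg _) (by positivity))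
    _ = (√C * √C) * (Real.exp (-(-z.im * d i * x)) * Real.exp (-z.im * d i * x + 2 * M₀ * x)
          * Real.exp (-z.im * d j * x + 2 * M₀ * x)
          * Real.exp (-(-z.im * d j * x + (4 * M₀ + 1) * x))) := by ring
    _ = C * Real.exp (-1 * x) := by
        rw [Real.mul_self_sqrt hC0, ← Real.exp_add, ← Real.exp_add, ← Real.exp_add]
        congr 2
        ring

/-- The cone property is recorded together with the Weyl property: with an unspecified r the
integral yields decay at the rate of the gap only far down in the half-plane, whereas the evolution
formula needs it for every Im z < -M. -/
theorem exists_isWeylFunction {M₀ M : ℝ} (hd : Antitone d) (hM₀ : 0 ≤ M₀) (hM : 0 ≤ M)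
    (hgap : HasGaps d M₀ M) (hcont : ContinuousOn ζ (Ici 0)) (hζ : ∀ x, 0 ≤ x → ‖ζ x‖ ≤ M₀) :
    ∃ φ : ℂ → Matrix (Fin m) (Fin m) ℂ, IsWeylFunction d ζ M φ ∧
      ∀ z ∈ lowerHalfPlane M, IsConeNormalized d ζ z (φ z) := by
  choose c g hg hsep hMg using hgap
  choose w hw using fun z => exists_isFundamentalSolution (d := d) hcont z
  have hz0 : ∀ z ∈ lowerHalfPlane M, z.im ≤ 0 := fun z hz => by
    have : z.im < -M := hz
    linarith
  have hzε : ∀ k, ∀ z ∈ lowerHalfPlane M, M₀ < -z.im * g k := fun k z hz => by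
    have : z.im < -M := hz
    nlinarith [hMg k, hg k]
  choose! f hflow hfcone using fun (k : Fin m) (z : ℂ) (hz : z ∈ lowerHalfPlane M) =>
    exists_weylVector (hsep k) (hz0 z hz) (hzε k z hz) hζ (hw z)
  set φ : ℂ → Matrix (Fin m) (Fin m) ℂ := fun z => Matrix.of fun i k => f k z i with hφ
  have hcol : ∀ z k, colVec (φ z) k = f k z := fun z k => rfl
  have hnorm : ∀ z ∈ lowerHalfPlane M, ∀ i j, (i = j → φ z i j = 1) ∧ (j < i → φ z i j = 0) := by
    intro z hz i j
    refine ⟨fun h => ?_, fun h => ?_⟩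
    · subst h
      have := hflow i z hz i le_rfl
      rwa [Pi.single_eq_same] at this
    · have := hflow j z hz i h.le
      rwa [Pi.single_eq_of_ne h.ne'] at this
  have hcone : ∀ z ∈ lowerHalfPlane M, IsConeNormalized d ζ z (φ z) := fun z hz =>
    ⟨hnorm z hz, fun w' hw' k x hx => by
      rw [hw'.eqOn hcont (hw z) hx, hcol]
      exact hfcone k z hz x hx⟩
  refine ⟨φ, ⟨?_, ⟨4 * M₀ + 1, by linarith, fun z hz => ⟨w z, hw z,
    integrableOn_weylIntegrand hd (hz0 z hz) hM₀ hζ (hcone z hz) (hw z)⟩⟩, hnorm⟩, hcone⟩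
  refine DifferentiableOn.analyticOnNhd ?_ (isOpen_lowerHalfPlane M)
  have hsum : φ = fun z => ∑ i, ∑ k, f k z i • Matrix.single i k (1 : ℂ) := by
    funext z
    conv_lhs => rw [Matrix.matrix_eq_sum_single (φ z)]
    simp [hφ]
  rw [hsum]
  exact DifferentiableOn.fun_sum fun i _ => DifferentiableOn.fun_sum fun k _ =>
    (differentiableOn_weylVector (hsep k) hM (hg k) (hMg k) hcont hζ hw (hflow k)
      (hfcone k) i).smul_const _

theorem IsWeylFunction.eqOn {M₀ M M' : ℝ} (hM : 0 ≤ M) (hgap : HasGaps d M₀ M)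
    (hcont : ContinuousOn ζ (Ici 0)) (hζ : ∀ x, 0 ≤ x → ‖ζ x‖ ≤ M₀)
    {φ χ : ℂ → Matrix (Fin m) (Fin m) ℂ} (hφ : IsWeylFunction d ζ M φ)
    (hχ : IsWeylFunction d ζ M' χ) :
    EqOn χ φ (lowerHalfPlane M ∩ lowerHalfPlane M') := by
  choose c g hg hsep hMg using hgap
  obtain ⟨r, hr, hφw⟩ := hφ.2.1
  obtain ⟨r', hr', hχw⟩ := hχ.2.1
  have hinter : lowerHalfPlane M ∩ lowerHalfPlane M' = lowerHalfPlane (max M M') := by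
    ext z
    simp only [lowerHalfPlane, mem_inter_iff, mem_ofPred_eq, lt_neg, max_lt_iff]
  -- Below -Y the loss r/2, for either Weyl function, is absorbed by the half-gap: (-Im z) d_k + r/2
  -- ≤ (-Im z) c_k.
  obtain ⟨Y, hY1, hY2, hY3⟩ : ∃ Y : ℝ, M < Y ∧ M' < Y ∧ ∀ k, max r r' / 2 ≤ Y * g k := by
    have hf : ∀ k : Fin m, ∃ Y : ℝ, 0 ≤ Y ∧ max r r' / 2 ≤ Y * g k := fun k =>
      ⟨max r r' / 2 / g k, by have := hg k; positivity, by rw [div_mul_cancel₀ _ (hg k).ne']⟩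
    choose Y hY0 hY using hf
    refine ⟨max M M' + 1 + ∑ k, Y k, ?_, ?_, fun k => ?_⟩
    · linarith [le_max_left M M', Finset.sum_nonneg fun k (_ : k ∈ Finset.univ) => hY0 k]
    · linarith [le_max_right M M', Finset.sum_nonneg fun k (_ : k ∈ Finset.univ) => hY0 k]
    · refine (hY k).trans (mul_le_mul_of_nonneg_right ?_ (hg k).le)
      have := Finset.single_le_sum (f := Y) (fun k _ => hY0 k) (Finset.mem_univ k)
      linarith [le_max_left M M']
  have key : ∀ z ∈ lowerHalfPlane Y, χ z = φ z := by
    intro z hz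
    have hzY : z.im < -Y := hz
    have hzM : z ∈ lowerHalfPlane M := show z.im < -M by linarith
    have hzM' : z ∈ lowerHalfPlane M' := show z.im < -M' by linarith
    obtain ⟨w, hw, hint⟩ := hφw z hzM
    obtain ⟨w', hw', hint'⟩ := hχw z hzM'
    have hdec := isDecaying_of_integrableOn_weylIntegrand hw hint
    have hdec' := isDecaying_of_integrableOn_weylIntegrand hw' hint'
    have hcol : ∀ k, colVec (χ z) k = colVec (φ z) k := by
      intro k
      have hck : d k ≤ c k - g k := (hsep k k).2 le_rfl
      have hbd : ∀ r₀, r₀ ≤ max r r' → -z.im * d k + r₀ / 2 ≤ -z.im * c k := by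
        intro r₀ hr₀
        have h1 : Y * g k ≤ -z.im * g k := mul_le_mul_of_nonneg_right (by linarith) (hg k).le
        have h2 : -z.im * d k ≤ -z.im * (c k - g k) :=
          mul_le_mul_of_nonneg_left hck (by linarith)
        linarith [hY3 k]
      refine eq_of_isDecaying (hsep k) (by linarith) ?_ hζ hw (fun i hi => ?_) ?_ ?_
      · have : M * g k ≤ -z.im * g k := mul_le_mul_of_nonneg_right (by linarith) (hg k).le
        linarith [hMg k]
      · rcases eq_or_lt_of_le hi with h | h
        · rw [colVec_apply, colVec_apply, (hχ.2.2 z hzM' i k).1 h.symm,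
            (hφ.2.2 z hzM i k).1 h.symm]
        · rw [colVec_apply, colVec_apply, (hχ.2.2 z hzM' i k).2 h, (hφ.2.2 z hzM i k).2 h]
      · have h := (hdec' k).mono (hw'.isVectorSolution _).continuousOn (hbd r' (le_max_right _ _))
        refine MeasureTheory.MemLp.ae_eq ?_ h
        refine (MeasureTheory.ae_restrict_iff' measurableSet_Ioi).2 (.of_forall fun x hx => ?_)
        beta_reduce
        rw [hw'.eqOn hcont hw (mem_Ici.2 (le_of_lt (mem_Ioi.1 hx)))]
      · exact (hdec k).mono (hw.isVectorSolution _).continuousOn (hbd r (le_max_left _ _))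
    ext i k
    exact congrArg (fun u : EuclideanSpace ℂ (Fin m) => u i) (hcol k)
  -- The common half-plane is connected, so agreement near one point below -Y propagates to all of
  -- it.
  have hconv : Convex ℝ (lowerHalfPlane (max M M')) := convex_halfSpace_im_lt _
  rw [hinter]
  have hz₀ : (⟨0, -Y - 1⟩ : ℂ) ∈ lowerHalfPlane Y := show -Y - 1 < -Y by linarith
  refine AnalyticOnNhd.eqOn_of_preconnected_of_eventuallyEq
    (hχ.1.mono (hinter ▸ inter_subset_right)) (hφ.1.mono (hinter ▸ inter_subset_left))
    hconv.isPreconnected (z₀ := ⟨0, -Y - 1⟩)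
    (show -Y - 1 < -max M M' by linarith [max_lt hY1 hY2]) ?_
  filter_upwards [(isOpen_lowerHalfPlane Y).mem_nhds hz₀] with z hz using key z hz

end NWave

/-! ### Compatible systems: invertibility and the factorization formula. -/

section Algebra

variable {𝔸 : Type*} [NormedRing 𝔸] [NormedAlgebra ℝ 𝔸]

/-- Solutions of linear equations are left invertible. -/
theorem exists_mul_solution_eq_one [CompleteSpace 𝔸] {A W : ℝ → 𝔸} {T : ℝ} (hT : 0 ≤ T)
    (hA : ContinuousOn A (Icc 0 T)) (hW0 : W 0 = 1)
    (hW : ∀ s ∈ Icc 0 T, HasDerivWithinAt W (A s * W s) (Icc 0 T) s) : ∃ X, X * W T = 1 := by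
  have hρ : ∀ x ∈ Icc 0 T, max 0 (min T x) = x := fun x hx => by
    rw [min_eq_right hx.2, max_eq_right hx.1]
  have hA' : Continuous (fun x => A (max 0 (min T x))) :=
    hA.comp_continuous (by fun_prop)
      fun x => ⟨le_max_left _ _, max_le hT (min_le_left _ _)⟩
  -- The left inverse is the solution of y' = -y A; the product y W then has derivative zero.
  obtain ⟨y, hy0, hy⟩ := exists_linearODE_solution
    (A := fun x => -(ContinuousLinearMap.mul ℝ 𝔸).flip (A (max 0 (min T x))))
    ((ContinuousLinearMap.mul ℝ 𝔸).flip.continuous.comp hA').neg 1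
  have hder : ∀ x ∈ Icc 0 T, HasDerivWithinAt (fun x => y x * W x) 0 (Icc 0 T) x := by
    intro x hx
    refine ((hy x).hasDerivWithinAt.mul (hW x hx)).congr_deriv ?_
    rw [hρ x hx]
    simp [mul_assoc]
  refine ⟨y T, ?_⟩
  have := constant_of_has_deriv_right_zero (fun x hx => (hder x hx).continuousWithinAt)
    (fun x hx => (hder x ⟨hx.1, hx.2.le⟩).mono_of_mem_nhdsWithin
      (mem_of_superset (Icc_mem_nhdsGE hx.2) (Icc_subset_Icc_left hx.1))) T ⟨hT, le_rfl⟩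
  rwa [hy0, hW0, one_mul] at this

/-- A function with jointly continuous partial derivative is differentiable uniformly on compact
parameter sets. -/
lemma eventually_norm_sub_sub_smul_le {E : Type*} [NormedAddCommGroup E] [NormedSpace ℝ E]
    {F Fx : ℝ → ℝ → E} {T x : ℝ} (hx : 0 ≤ x)
    (hF : ∀ y, 0 ≤ y → ∀ s ∈ Icc 0 T, HasDerivWithinAt (fun y => F y s) (Fx y s) (Ici 0) y)
    (hFx : ContinuousOn (fun p : ℝ × ℝ => Fx p.1 p.2) (Ici 0 ×ˢ Icc 0 T)) {ε : ℝ} (hε : 0 < ε) :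
    ∀ᶠ q in 𝓝[Ici 0] x, ∀ s ∈ Icc 0 T, ‖F q s - F x s - (q - x) • Fx x s‖ ≤ ε * ‖q - x‖ := by
  have huc := ((isCompact_Icc (a := 0) (b := x + 1)).prod (isCompact_Icc (a := 0) (b := T)))
    |>.uniformContinuousOn_of_continuous (hFx.mono (prod_mono Icc_subset_Ici_self subset_rfl))
  obtain ⟨δ, hδ, hδε⟩ := Metric.uniformContinuousOn_iff.1 huc ε hε
  have hball : Metric.ball x (min δ 1) ∈ 𝓝[Ici 0] x :=
    mem_nhdsWithin_of_mem_nhds (Metric.ball_mem_nhds x (by positivity))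
  filter_upwards [hball, self_mem_nhdsWithin] with q hq hq0 s hs
  have hconv : Convex ℝ (Ici 0 ∩ Metric.ball x (min δ 1)) := (convex_Ici 0).inter (convex_ball _ _)
  -- Mean value inequality for F minus its linear part; uniform continuity of Fx makes the
  -- neighbourhood independent of s.
  have h := hconv.norm_image_sub_le_of_norm_hasDerivWithin_le
    (f := fun y => F y s - y • Fx x s) (f' := fun y => Fx y s - (1 : ℝ) • Fx x s) (C := ε)
    (fun y hy => ((hF y hy.1 s hs).mono inter_subset_left).sub
      ((hasDerivWithinAt_id y _).smul_const _))
    (fun y hy => by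
      have hy2 := hy.2
      rw [Metric.mem_ball, Real.dist_eq] at hy2
      have h1 : |y - x| < 1 := hy2.trans_le (min_le_right _ _)
      have h2 : |y - x| < δ := hy2.trans_le (min_le_left _ _)
      have := hδε (y, s) ⟨⟨hy.1, by linarith [(abs_lt.1 h1).2]⟩, hs⟩ (x, s)
        ⟨⟨hx, by linarith⟩, hs⟩ (by rw [Prod.dist_eq, dist_self, max_eq_left dist_nonneg]; exact h2)
      rw [dist_eq_norm] at this
      rw [one_smul]
      exact this.le)
    (x := x) (y := q) ⟨hx, Metric.mem_ball_self (by positivity)⟩ ⟨hq0, hq⟩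
  refine le_of_eq_of_le (congrArg norm ?_) h
  module

/-- The factorization formula for fundamental solutions of a compatible pair of systems
`w_x = G w`, `R_t = F R` with `G_t - F_x + [G, F] = 0`. -/
theorem fundamentalSolution_factorization {F Fx G Gt R : ℝ → ℝ → 𝔸} {w₀ w₁ : ℝ → 𝔸} {T : ℝ}
    (hT : 0 ≤ T)
    (hF : ∀ y, 0 ≤ y → ∀ s ∈ Icc 0 T, HasDerivWithinAt (fun y => F y s) (Fx y s) (Ici 0) y)
    (hFx : ContinuousOn (fun p : ℝ × ℝ => Fx p.1 p.2) (Ici 0 ×ˢ Icc 0 T))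
    (hFc : ∀ y, 0 ≤ y → ContinuousOn (F y) (Icc 0 T))
    (hG : ∀ y, 0 ≤ y → ∀ s ∈ Icc 0 T, HasDerivWithinAt (G y) (Gt y s) (Icc 0 T) s)
    (hGc : ContinuousOn (fun y => G y T) (Ici 0))
    (hzc : ∀ y, 0 ≤ y → ∀ s ∈ Icc 0 T, Gt y s - Fx y s + (G y s * F y s - F y s * G y s) = 0)
    (hR0 : ∀ y, 0 ≤ y → R y 0 = 1)
    (hR : ∀ y, 0 ≤ y → ∀ s ∈ Icc 0 T, HasDerivWithinAt (R y) (F y s * R y s) (Icc 0 T) s)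
    (hw₀0 : w₀ 0 = 1) (hw₀ : ∀ x ∈ Ici (0 : ℝ), HasDerivWithinAt w₀ (G x 0 * w₀ x) (Ici 0) x)
    (hw₁0 : w₁ 0 = 1) (hw₁ : ∀ x ∈ Ici (0 : ℝ), HasDerivWithinAt w₁ (G x T * w₁ x) (Ici 0) x)
    {x : ℝ} (hx : 0 ≤ x) : w₁ x * R 0 T = R x T * w₀ x := by
  have hRx : ∀ y, 0 ≤ y → HasDerivWithinAt (fun y => R y T)
      (G y T * R y T - R y T * G y 0) (Ici 0) y := by
    intro y hy
    obtain ⟨K₁, hK₁⟩ := (isCompact_Icc (a := 0) (b := T)).exists_bound_of_continuousOn (hFc y hy)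
    obtain ⟨K₂, hK₂⟩ := (isCompact_Icc (a := 0) (b := T)).exists_bound_of_continuousOn
      (f := fun s => Fx y s) (hFx.comp (f := fun s => (y, s)) (by fun_prop)
        fun s hs => ⟨hy, hs⟩)
    -- The guess S = G R - R G(·, 0) vanishes at s = 0, and zero curvature turns its s-derivative
    -- into F S + Fx R. So S is the x-derivative of R, without any mixed second derivative.
    refine hasDerivWithinAt_solution_of_param (𝕜 := ℝ) (P := Ici 0) (p := y) hy (A := F) (W := R)
      (B := fun s => Fx y s) (S := fun s => G y s * R y s - R y s * G y 0) hT (K := max K₁ K₂)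
      (fun s hs => (hK₁ s hs).trans (le_max_left _ _))
      (fun s hs => (hK₂ s hs).trans (le_max_right _ _))
      (fun q hq => (hR0 q hq).trans (hR0 y hy).symm) (by simp [hR0 y hy])
      (fun ε hε => eventually_norm_sub_sub_smul_le hy hF hFx hε) hR fun s hs => ?_
    refine (((hG y hy s hs).mul (hR y hy s hs)).sub ((hR y hy s hs).mul_const _)).congr_deriv ?_
    have : Gt y s = Fx y s - (G y s * F y s - F y s * G y s) := by
      rw [eq_sub_iff_add_eq, ← sub_eq_zero, ← hzc y hy s hs]
      abel
    rw [this]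
    noncomm_ring
  obtain ⟨K, hK⟩ := (isCompact_Icc (a := 0) (b := x)).exists_bound_of_continuousOn
    (hGc.mono Icc_subset_Ici_self)
  -- Both sides solve y' = G(·, T) y with the value R 0 T at x = 0.
  refine linearODE_solution_unique (A := fun y => G y T) (W := fun y => w₁ y * R 0 T)
    (W' := fun y => R y T * w₀ y) hK (by simp [hw₀0, hw₁0]) (fun s hs => ?_) (fun s hs => ?_)
    ⟨hx, le_rfl⟩
  · have := ((hw₁ s hs.1).mul_const (R 0 T)).mono (Icc_subset_Ici_self : Icc 0 x ⊆ Ici 0)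
    rwa [mul_assoc] at this
  · refine (((hRx s hs.1).mul (hw₀ s hs.1)).mono
      (Icc_subset_Ici_self : Icc 0 x ⊆ Ici 0)).congr_deriv ?_
    noncomm_ring

end Algebra

/-! ### Zero curvature for the N-wave equation and transport of decay in t. -/

namespace NWave

variable {m : ℕ} {d dhat : Fin m → ℝ}

lemma timeInterval_Icc_subset {a : EReal} {T : ℝ} (hT : T ∈ timeInterval a) :
    Icc 0 T ⊆ timeInterval a := fun _ hs =>
  ⟨hs.1, (EReal.coe_le_coe_iff.2 hs.2).trans_lt hT.2⟩

lemma convex_timeInterval (a : EReal) : Convex ℝ (timeInterval a) := by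
  refine OrdConnected.convex ⟨fun x hx y hy s hs => ⟨hx.1.trans hs.1, ?_⟩⟩
  exact (EReal.coe_le_coe_iff.2 hs.2).trans_lt hy.2

lemma uniqueDiffOn_timeInterval {a : EReal} (ha : 0 < a) : UniqueDiffOn ℝ (timeInterval a) := by
  refine uniqueDiffOn_convex (convex_timeInterval a) ?_
  obtain ⟨b, hb0, hba⟩ := EReal.lt_iff_exists_real_btwn.1 ha
  have hb0' : 0 < b := by exact_mod_cast hb0
  have : Ioo 0 b ⊆ timeInterval a := fun s hs =>
    ⟨hs.1.le, (EReal.coe_le_coe_iff.2 hs.2.le).trans_lt hba⟩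
  exact (nonempty_Ioo.2 hb0').mono (interior_maximal this isOpen_Ioo)

section Smooth

variable {E : Type*} [NormedAddCommGroup E] [NormedSpace ℝ E] {a : EReal} {ϱ : ℝ → ℝ → E}

lemma hasDerivWithinAt_fst (hϱ : ContDiffOn ℝ 1 (fun p : ℝ × ℝ => ϱ p.1 p.2) (semiStrip a))
    {x t : ℝ} (hx : 0 ≤ x) (ht : t ∈ timeInterval a) :
    HasDerivWithinAt (fun y => ϱ y t)
      (fderivWithin ℝ (fun p : ℝ × ℝ => ϱ p.1 p.2) (semiStrip a) (x, t) (1, 0)) (Ici 0) x := by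
  have h := (hϱ.differentiableOn one_ne_zero (x, t) ⟨hx, ht⟩).hasFDerivWithinAt
  exact h.comp_hasDerivWithinAt (f := fun y => (y, t)) x
    ((hasDerivWithinAt_id x _).prodMk (hasDerivWithinAt_const x _ t)) fun y hy => ⟨hy, ht⟩

lemma hasDerivWithinAt_snd (hϱ : ContDiffOn ℝ 1 (fun p : ℝ × ℝ => ϱ p.1 p.2) (semiStrip a))
    {x t : ℝ} (hx : 0 ≤ x) (ht : t ∈ timeInterval a) :
    HasDerivWithinAt (fun s => ϱ x s)
      (fderivWithin ℝ (fun p : ℝ × ℝ => ϱ p.1 p.2) (semiStrip a) (x, t) (0, 1))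
      (timeInterval a) t := by
  have h := (hϱ.differentiableOn one_ne_zero (x, t) ⟨hx, ht⟩).hasFDerivWithinAt
  exact h.comp_hasDerivWithinAt (f := fun s => (x, s)) t
    ((hasDerivWithinAt_const t _ x).prodMk (hasDerivWithinAt_id t _)) fun s hs => ⟨hx, hs⟩

lemma continuousOn_derivWithin_fst (ha : 0 < a)
    (hϱ : ContDiffOn ℝ 1 (fun p : ℝ × ℝ => ϱ p.1 p.2) (semiStrip a)) :
    ContinuousOn (fun p : ℝ × ℝ => derivWithin (fun y => ϱ y p.2) (Ici 0) p.1) (semiStrip a) := by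
  have hu : UniqueDiffOn ℝ (semiStrip a) :=
    (uniqueDiffOn_Ici 0).prod (uniqueDiffOn_timeInterval ha)
  refine ((hϱ.continuousOn_fderivWithin hu le_rfl).clm_apply
    (continuousOn_const (c := ((1 : ℝ), (0 : ℝ))))).congr fun p hp => ?_
  exact (hasDerivWithinAt_fst hϱ hp.1 hp.2).derivWithin (uniqueDiffOn_Ici 0 p.1 hp.1)

end Smooth

lemma diagMat_mul_comm (d d' : Fin m → ℝ) :
    diagMat d * diagMat d' = diagMat d' * diagMat d := by
  simp only [diagMat, Matrix.diagonal_mul_diagonal, mul_comm]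

/-- The zero curvature representation of the `N`-wave equation. -/
lemma zeroCurvature {D D' ρ ρt ρx : Matrix (Fin m) (Fin m) ℂ} (hDD' : D * D' = D' * D)
    (h : ⁅D, ρt⁆ - ⁅D', ρx⁆ = ⁅D, ρ⁆ * ⁅D', ρ⁆ - ⁅D', ρ⁆ * ⁅D, ρ⁆) (c : ℂ) :
    -⁅D, ρt⁆ - -⁅D', ρx⁆ + ((c • D - ⁅D, ρ⁆) * (c • D' - ⁅D', ρ⁆)
      - (c • D' - ⁅D', ρ⁆) * (c • D - ⁅D, ρ⁆)) = 0 := by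
  -- Expansion in powers of c. The c² coefficient is [D, D'] = 0, the c coefficient is, up to sign,
  -- [[D, D'], ρ] by the Jacobi identity, and the constant term is the N-wave nonlinearity.
  have h1 : (c • D - ⁅D, ρ⁆) * (c • D' - ⁅D', ρ⁆) - (c • D' - ⁅D', ρ⁆) * (c • D - ⁅D, ρ⁆)
      = c • c • (D * D' - D' * D)
        - c • (D * ⁅D', ρ⁆ - ⁅D', ρ⁆ * D - (D' * ⁅D, ρ⁆ - ⁅D, ρ⁆ * D'))
        + (⁅D, ρ⁆ * ⁅D', ρ⁆ - ⁅D', ρ⁆ * ⁅D, ρ⁆) := by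
    simp only [sub_mul, mul_sub, smul_mul_assoc, mul_smul_comm]
    module
  have h2 : D * ⁅D', ρ⁆ - ⁅D', ρ⁆ * D - (D' * ⁅D, ρ⁆ - ⁅D, ρ⁆ * D')
      = (D * D' - D' * D) * ρ - ρ * (D * D' - D' * D) := by
    simp only [Ring.lie_def]
    noncomm_ring
  rw [h1, h2, hDD', ← h]
  simp

section Evolution

variable {a : EReal} {ϱ : ℝ → ℝ → Matrix (Fin m) (Fin m) ℂ}

lemma continuousOn_lie {X : Type*} [TopologicalSpace X] {s : Set X}
    {f : X → Matrix (Fin m) (Fin m) ℂ} (hf : ContinuousOn f s) (D : Matrix (Fin m) (Fin m) ℂ) :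
    ContinuousOn (fun x => ⁅D, f x⁆) s := by
  simp only [Ring.lie_def]
  exact (continuousOn_const.mul hf).sub (hf.mul continuousOn_const)

lemma hasDerivWithinAt_lie {f : ℝ → Matrix (Fin m) (Fin m) ℂ} {f' : Matrix (Fin m) (Fin m) ℂ}
    {s : Set ℝ} {x : ℝ} (hf : HasDerivWithinAt f f' s x) (D : Matrix (Fin m) (Fin m) ℂ) :
    HasDerivWithinAt (fun x => ⁅D, f x⁆) ⁅D, f'⁆ s x := by
  simp only [Ring.lie_def]
  exact (hf.const_mul D).sub (hf.mul_const D)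

lemma norm_lie_le (A B : Matrix (Fin m) (Fin m) ℂ) : ‖⁅A, B⁆‖ ≤ 2 * ‖A‖ * ‖B‖ := by
  rw [Ring.lie_def]
  have h1 := norm_mul_le A B
  have h2 := norm_mul_le B A
  have h3 := norm_sub_le (A * B) (B * A)
  linarith

/-- The solution at `x = 0` of the auxiliary system in `t` intertwines the fundamental solutions
in `x`, up to a factor that is bounded in `x`. -/
theorem exists_bounded_factor (ha : 0 < a)
    (hϱ_smooth : ContDiffOn ℝ 1 (fun p : ℝ × ℝ => ϱ p.1 p.2) (semiStrip a))
    {C : ℝ} (hC : ∀ x t : ℝ, 0 ≤ x → t ∈ timeInterval a → ‖ϱ x t‖ ≤ C)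
    (hϱ : IsNWaveSolution d dhat a ϱ) {z : ℂ} {R : ℝ → Matrix (Fin m) (Fin m) ℂ}
    (hR : IsFundamentalSolution dhat (fun t => ⁅diagMat dhat, ϱ 0 t⁆) (timeInterval a) z R)
    {T : ℝ} (hT : T ∈ timeInterval a) {w₀ w₁ : ℝ → Matrix (Fin m) (Fin m) ℂ}
    (hw₀ : IsFundamentalSolution d (fun x => ⁅diagMat d, ϱ x 0⁆) (Ici 0) z w₀)
    (hw₁ : IsFundamentalSolution d (fun x => ⁅diagMat d, ϱ x T⁆) (Ici 0) z w₁) :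
    ∃ B : ℝ, ∀ x, 0 ≤ x → ∃ V : Matrix (Fin m) (Fin m) ℂ, ‖V‖ ≤ B ∧ w₁ x * R T = V * w₀ x := by
  have hT0 : 0 ≤ T := hT.1
  have hsub := timeInterval_Icc_subset hT
  have hct : ∀ y, 0 ≤ y → ContinuousOn (ϱ y) (Icc 0 T) := fun y hy =>
    hϱ_smooth.continuousOn.comp (f := fun s => (y, s)) (by fun_prop) fun s hs => ⟨hy, hsub hs⟩
  have hcx : ContinuousOn (fun y => ϱ y T) (Ici 0) :=
    hϱ_smooth.continuousOn.comp (f := fun y => (y, T)) (by fun_prop) fun y hy => ⟨hy, hT⟩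
  set F : ℝ → ℝ → Matrix (Fin m) (Fin m) ℂ := fun y s =>
    (Complex.I * z) • diagMat dhat - ⁅diagMat dhat, ϱ y s⁆ with hF
  have hFc : ∀ y, 0 ≤ y → ContinuousOn (F y) (Icc 0 T) := fun y hy =>
    continuousOn_const.sub (continuousOn_lie (hct y hy) _)
  choose! P hP0 hP using fun y (hy : 0 ≤ y) =>
    exists_fundamentalMatrix (s := Icc 0 T) (fun x => max 0 (min T x)) (by fun_prop)
      (fun x => ⟨le_max_left _ _, max_le hT0 (min_le_left _ _)⟩)
      (fun x hx => by rw [min_eq_right hx.2, max_eq_right hx.1]) (hFc y hy)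
  -- The bound on ϱ makes K independent of y; this is what makes P y T bounded in y. The maximum
  -- with 1 meets the requirement of the Grönwall estimate.
  set K := ‖(Complex.I * z) • diagMat dhat‖ + 2 * ‖diagMat dhat‖ * C with hK
  have hFK : ∀ y, 0 ≤ y → ∀ s ∈ Icc 0 T, ‖F y s‖ ≤ max 1 K := by
    intro y hy s hs
    refine le_trans ?_ (le_max_right _ _)
    refine (norm_sub_le _ _).trans (add_le_add le_rfl ((norm_lie_le _ _).trans ?_))
    exact mul_le_mul_of_nonneg_left (hC y s hy (hsub hs)) (by positivity)
  have hPR : P 0 T = R T :=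
    linearODE_solution_unique (hFK 0 le_rfl) ((hP0 0 le_rfl).trans hR.1.symm) (hP 0 le_rfl)
      (fun s hs => (hR.2 s (hsub hs)).mono hsub) ⟨hT0, le_rfl⟩
  refine ⟨‖(1 : Matrix (Fin m) (Fin m) ℂ)‖ * Real.exp (max 1 K * T), fun x hx => ⟨P x T, ?_, ?_⟩⟩
  · exact norm_solution_le (le_max_left _ _) (hFK x hx) (by rw [hP0 x hx]) (hP x hx) T
      ⟨hT0, le_rfl⟩
  · rw [← hPR]
    refine fundamentalSolution_factorization (F := F)
      (Fx := fun y s => -⁅diagMat dhat, derivWithin (fun y => ϱ y s) (Ici 0) y⁆)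
      (G := fun y s => (Complex.I * z) • diagMat d - ⁅diagMat d, ϱ y s⁆)
      (Gt := fun y s => -⁅diagMat d, derivWithin (fun s => ϱ y s) (timeInterval a) s⁆)
      hT0 (fun y hy s hs => ?_) ?_ hFc (fun y hy s hs => ?_)
      (continuousOn_const.sub (continuousOn_lie hcx _)) (fun y hy s hs => ?_) hP0 hP hw₀.1 hw₀.2
      hw₁.1 hw₁.2 hx
    · have h := hasDerivWithinAt_fst hϱ_smooth hy (hsub hs)
      exact (hasDerivWithinAt_lie h.differentiableWithinAt.hasDerivWithinAt _).const_sub _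
    · refine (continuousOn_lie ?_ _).neg
      exact (continuousOn_derivWithin_fst ha hϱ_smooth).mono (prod_mono subset_rfl hsub)
    · have h := hasDerivWithinAt_snd hϱ_smooth hy (hsub hs)
      exact ((hasDerivWithinAt_lie
        h.differentiableWithinAt.hasDerivWithinAt _).const_sub _).mono hsub
    · exact zeroCurvature (diagMat_mul_comm d dhat) (hϱ y s hy (hsub hs)).2 _

/-- The decay class of initial values is transported by the auxiliary system in `t`. -/
lemma IsDecaying.transport {ζ : ℝ → Matrix (Fin m) (Fin m) ℂ} {z : ℂ} {B κ : ℝ}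
    {w₀ w₁ : ℝ → Matrix (Fin m) (Fin m) ℂ} {U : Matrix (Fin m) (Fin m) ℂ}
    (hw₁ : IsFundamentalSolution d ζ (Ici 0) z w₁)
    (hV : ∀ x, 0 ≤ x → ∃ V : Matrix (Fin m) (Fin m) ℂ, ‖V‖ ≤ B ∧ w₁ x * U = V * w₀ x)
    {f : EuclideanSpace ℂ (Fin m)}
    (hf : IsDecaying κ (fun x => Matrix.toEuclideanCLM (𝕜 := ℂ) (w₀ x) f)) :
    IsDecaying κ (fun x => Matrix.toEuclideanCLM (𝕜 := ℂ) (w₁ x)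
      (Matrix.toEuclideanCLM (𝕜 := ℂ) U f)) := by
  refine MeasureTheory.MemLp.of_le_mul (c := B) hf ?_ ?_
  · exact ((by fun_prop : Continuous fun x : ℝ => Real.exp (-(κ * x))).continuousOn.smul
      ((hw₁.isVectorSolution _).continuousOn.mono Ioi_subset_Ici_self)).aestronglyMeasurable
        measurableSet_Ioi
  · refine (MeasureTheory.ae_restrict_iff' measurableSet_Ioi).2 (.of_forall fun x hx => ?_)
    obtain ⟨V, hVB, hVw⟩ := hV x (le_of_lt hx)
    rw [norm_smul, norm_smul, mul_left_comm]
    refine mul_le_mul_of_nonneg_left ?_ (norm_nonneg _)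
    have h := congrArg (fun A => Matrix.toEuclideanCLM (𝕜 := ℂ) A f) hVw
    simp only [map_mul] at h
    change Matrix.toEuclideanCLM (𝕜 := ℂ) (w₁ x) (Matrix.toEuclideanCLM (𝕜 := ℂ) U f)
      = Matrix.toEuclideanCLM (𝕜 := ℂ) V (Matrix.toEuclideanCLM (𝕜 := ℂ) (w₀ x) f) at h
    beta_reduce
    rw [h]
    exact (ContinuousLinearMap.le_opNorm _ _).trans (mul_le_mul_of_nonneg_right
      ((Matrix.l2_opNorm_toEuclideanCLM V).le.trans hVB) (norm_nonneg _))

end Evolution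

end NWave

/-! ### Linear-fractional recovery of the Weyl function. -/

namespace NWave

variable {m : ℕ} {d : Fin m → ℝ} {ζ : ℝ → Matrix (Fin m) (Fin m) ℂ} {z : ℂ}

lemma hasGaps_of_forall_lt {M₀ M : ℝ} (hd : StrictAnti d) (hM₀ : 0 ≤ M₀) (hM : 0 < M)
    (h : ∀ i j : Fin m, (i : ℕ) + 1 = (j : ℕ) → 2 * M₀ / (d i - d j) < M) :
    HasGaps d M₀ M := by
  intro k
  by_cases hk : (k : ℕ) = 0
  -- For k = 0 no weight has to lie above the gap, so its size is free; this one gives M * g = M₀ +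
  -- 1.
  · refine ⟨d k + (M₀ + 1) / M, (M₀ + 1) / M, by positivity, fun i => ⟨fun hi => ?_, fun hi => ?_⟩,
      ?_⟩
    · exact absurd (Fin.lt_def.1 hi) (by omega)
    · rw [add_sub_cancel_right]
      exact hd.antitone hi
    · rw [mul_div_cancel₀ _ hM.ne']
      linarith
  -- With zero-based k the relevant gap is between d (k - 1) and d k. Half its width as g accounts
  -- for the factor 2 in the condition on M.
  · set l : Fin m := ⟨k - 1, by omega⟩ with hl
    have hlk : l < k := Fin.lt_def.2 (by simp only [hl]; omega)
    have hg : 0 < d l - d k := sub_pos.2 (hd hlk)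
    refine ⟨(d l + d k) / 2, (d l - d k) / 2, by linarith, fun i => ⟨fun hi => ?_, fun hi => ?_⟩,
      ?_⟩
    · have : i ≤ l := Fin.le_def.2 (by simp only [hl]; have := Fin.lt_def.1 hi; omega)
      linarith [hd.antitone this]
    · linarith [hd.antitone hi]
    · have := h l k (by simp only [hl]; omega)
      rw [div_lt_iff₀ hg] at this
      linarith

/-- Raising k only turns minus signs into plus signs, so the cone of index j lies inside that of k ≤
j. Hence all columns of index ≥ k decay at the rate of the k-th gap. -/
lemma coneForm_antitone {k j : Fin m} (h : k ≤ j) (u : EuclideanSpace ℂ (Fin m)) :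
    coneForm k u ≤ coneForm j u := by
  refine weightedSq_mono (fun i => ?_) u
  split_ifs with h1 h2
  · exact le_rfl
  · exact absurd (h1.trans_le h) h2
  · norm_num
  · exact le_rfl

/-- Normalized triangular matrices are injective. -/
lemma eq_zero_of_mulVec_eq_zero_of_normalized {φ : Matrix (Fin m) (Fin m) ℂ}
    (hφ : ∀ i j, (i = j → φ i j = 1) ∧ (j < i → φ i j = 0)) {v : Fin m → ℂ}
    (h : φ *ᵥ v = 0) : v = 0 := by
  have hdet : φ.det = 1 := by
    rw [Matrix.det_of_isUpperTriangular (fun i j hij => (hφ i j).2 hij)]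
    exact Finset.prod_eq_one fun i _ => (hφ i i).1 rfl
  exact Matrix.eq_zero_of_mulVec_eq_zero (by rw [hdet]; exact one_ne_zero) h

/-- The columns of index `≥ k` of a cone normalized matrix are decaying. -/
lemma IsConeNormalized.isDecaying {φ : Matrix (Fin m) (Fin m) ℂ}
    (hφ : IsConeNormalized d ζ z φ) {k : Fin m} {c g M₀ : ℝ} (hsep : IsSeparated d k c g)
    (hz : z.im ≤ 0) (hε : M₀ < -z.im * g) (hζ : ∀ x, 0 ≤ x → ‖ζ x‖ ≤ M₀)
    {w : ℝ → Matrix (Fin m) (Fin m) ℂ} (hw : IsFundamentalSolution d ζ (Ici 0) z w)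
    {j : Fin m} (hkj : k ≤ j) :
    IsDecaying (-z.im * c) (fun x => Matrix.toEuclideanCLM (𝕜 := ℂ) (w x) (colVec φ j)) :=
  isDecaying_of_coneForm_nonpos hsep hz hε hζ (hw.isVectorSolution _)
    fun x hx => (coneForm_antitone hkj _).trans (hφ.2 w hw j x hx)

/-- Extension of a vector by zero. -/
def extendLower (k : Fin m) (v : {j : Fin m // k ≤ j} → ℂ) : Fin m → ℂ :=
  fun j => if h : k ≤ j then v ⟨j, h⟩ else 0

lemma mulVec_extendLower {k : Fin m} (A : Matrix (Fin m) (Fin m) ℂ)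
    (v : {j : Fin m // k ≤ j} → ℂ) (i : Fin m) :
    (A *ᵥ extendLower k v) i = ∑ j : {j : Fin m // k ≤ j}, A i j * v j := by
  have h : ∑ j ∈ Finset.univ.filter (k ≤ ·), A i j * extendLower k v j
      = ∑ j, A i j * extendLower k v j :=
    Finset.sum_subset (Finset.subset_univ _) fun j _ hj => by
      rw [extendLower, dif_neg (by simpa using hj), mul_zero]
  rw [Matrix.mulVec, dotProduct, ← h, Finset.sum_subtype (p := (k ≤ ·)) _ (by simp)]
  exact Finset.sum_congr rfl fun j _ => by rw [extendLower, dif_pos j.2]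

/-- A matrix whose columns of index `≥ k` are decaying has an invertible lower block, and the
linear fractional expression recovers the normalized decaying vector. -/
theorem psiBreve_mulVec_single {k : Fin m} {c g M₀ : ℝ} (hsep : IsSeparated d k c g)
    (hz : z.im ≤ 0) (hε : M₀ < -z.im * g) (hζ : ∀ x, 0 ≤ x → ‖ζ x‖ ≤ M₀)
    {w : ℝ → Matrix (Fin m) (Fin m) ℂ} (hw : IsFundamentalSolution d ζ (Ici 0) z w)
    {A φ : Matrix (Fin m) (Fin m) ℂ} (hA : ∀ v, A *ᵥ v = 0 → v = 0)
    (hAdec : ∀ j, k ≤ j →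
      IsDecaying (-z.im * c) (fun x => Matrix.toEuclideanCLM (𝕜 := ℂ) (w x) (colVec A j)))
    (hφ : IsConeNormalized d ζ z φ) :
    IsUnit (lowerBlock k A) ∧ ∀ (i : Fin m) (hi : i < k),
      φ i k = (psiBreve k A *ᵥ Pi.single ⟨k, le_refl k⟩ 1) ⟨i, hi⟩ := by
  have hdec : ∀ v : {j : Fin m // k ≤ j} → ℂ, IsDecaying (-z.im * c)
      (fun x => Matrix.toEuclideanCLM (𝕜 := ℂ) (w x)
        (WithLp.toLp 2 (A *ᵥ extendLower k v))) := by
    intro v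
    have h : WithLp.toLp 2 (A *ᵥ extendLower k v)
        = ∑ j : {j : Fin m // k ≤ j}, v j • colVec A j := by
      ext i
      simp [mulVec_extendLower, mul_comm]
    have h1 := MeasureTheory.memLp_finsetSum (Finset.univ : Finset {j : Fin m // k ≤ j})
      fun j _ => (hAdec j j.2).const_smul (v j)
    refine h1.ae_eq (.of_forall fun x => ?_)
    simp only [h, map_sum, map_smul, Finset.smul_sum, Pi.smul_apply]
    exact Finset.sum_congr rfl fun j _ => smul_comm _ _ _
  have hlow : ∀ (v : {j : Fin m // k ≤ j} → ℂ) (i : Fin m) (hi : k ≤ i),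
      (A *ᵥ extendLower k v) i = (lowerBlock k A *ᵥ v) ⟨i, hi⟩ := fun v i hi =>
    mulVec_extendLower A v i
  -- A kernel vector gives a decaying combination of columns with zero lower part; it vanishes by
  -- uniqueness, and A is injective.
  have hinj : ∀ v : {j : Fin m // k ≤ j} → ℂ, lowerBlock k A *ᵥ v = 0 → v = 0 := by
    intro v hv
    have h0 : WithLp.toLp 2 (A *ᵥ extendLower k v) = 0 := by
      refine eq_of_isDecaying hsep hz hε.le hζ hw (fun i hi => ?_) (hdec v) ?_
      · change (A *ᵥ extendLower k v) i = 0
        rw [hlow v i hi, hv, Pi.zero_apply]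
      · simp [IsDecaying]
    have h1 := hA _ (congrArg WithLp.ofLp h0)
    funext j
    have := congrFun h1 j
    rwa [extendLower, dif_pos j.2] at this
  have hunit : IsUnit (lowerBlock k A) := by
    rw [← Matrix.mulVec_injective_iff_isUnit]
    exact (injective_iff_map_eq_zero (lowerBlock k A).mulVecLin).2 hinj
  refine ⟨hunit, fun i hi => ?_⟩
  set v := (lowerBlock k A)⁻¹ *ᵥ Pi.single ⟨k, le_refl k⟩ (1 : ℂ) with hv
  have hLv : lowerBlock k A *ᵥ v = Pi.single ⟨k, le_refl k⟩ 1 := by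
    rw [hv, Matrix.mulVec_mulVec,
      Matrix.mul_nonsing_inv _ ((Matrix.isUnit_iff_isUnit_det _).1 hunit), Matrix.one_mulVec]
  -- Both vectors are decaying with lower part e_k, hence equal; the upper coordinates of the
  -- right-hand side form the linear-fractional expression.
  have heq : colVec φ k = WithLp.toLp 2 (A *ᵥ extendLower k v) := by
    refine eq_of_isDecaying hsep hz hε.le hζ hw (fun i hi => ?_)
      (hφ.isDecaying hsep hz hε hζ hw le_rfl) (hdec v)
    change φ i k = (A *ᵥ extendLower k v) i
    rw [hlow v i hi, hLv]
    rcases eq_or_lt_of_le hi with h | h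
    · subst h
      rw [(hφ.1 k k).1 rfl, Pi.single_eq_same]
    · rw [(hφ.1 i k).2 h, Pi.single_eq_of_ne]
      exact fun h' => h.ne' (congrArg Subtype.val h')
  have h := congrArg (fun u : EuclideanSpace ℂ (Fin m) => u i) heq
  change φ i k = (A *ᵥ extendLower k v) i at h
  rw [h, psiBreve, ← Matrix.mulVec_mulVec, ← hv]
  exact mulVec_extendLower A v i

end NWave

end

/-! ### Assembly of the theorem. -/

theorem mainTheorem3 (m : ℕ) (d dhat : Fin m → ℝ)
    (hd : StrictAnti d) (hdpos : ∀ i, 0 < d i) (hdhat : ∀ i, 0 < dhat i)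
    (a : EReal) (ha : 0 < a)
    (ϱ : ℝ → ℝ → Matrix (Fin m) (Fin m) ℂ)
    (hϱ_smooth : ContDiffOn ℝ 1 (fun p : ℝ × ℝ => ϱ p.1 p.2) (NWave.semiStrip a))
    (hϱ_bdd : ∃ C : ℝ, ∀ x t : ℝ, 0 ≤ x → t ∈ NWave.timeInterval a → ‖ϱ x t‖ ≤ C)
    (hϱ : NWave.IsNWaveSolution d dhat a ϱ)
    (ρhat : ℝ → Matrix (Fin m) (Fin m) ℂ)
    (hρhat : ∀ t ∈ NWave.timeInterval a, ϱ 0 t = ρhat t)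
    (R : ℝ → ℂ → Matrix (Fin m) (Fin m) ℂ)
    (hR : ∀ z : ℂ, NWave.IsFundamentalSolution dhat
      (fun t => ⁅NWave.diagMat dhat, ρhat t⁆) (NWave.timeInterval a) z (fun t => R t z))
    (M₀ M : ℝ)
    (hM₀ : ∀ x t : ℝ, 0 ≤ x → t ∈ NWave.timeInterval a → ‖⁅NWave.diagMat d, ϱ x t⁆‖ ≤ M₀)
    (hMpos : 0 < M)
    (hM : ∀ i j : Fin m, (i : ℕ) + 1 = (j : ℕ) → 2 * M₀ / (d i - d j) < M) :
    ∃ φ : ℝ → ℂ → Matrix (Fin m) (Fin m) ℂ,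
      -- `φ t` is the Weyl function of the system with potential `[D, ϱ(·, t)]`
      (∀ t ∈ NWave.timeInterval a,
        NWave.IsWeylFunction d (fun x => ⁅NWave.diagMat d, ϱ x t⁆) M (φ t) ∧
        ∀ (M' : ℝ) (χ : ℂ → Matrix (Fin m) (Fin m) ℂ), 0 < M' →
          NWave.IsWeylFunction d (fun x => ⁅NWave.diagMat d, ϱ x t⁆) M' χ →
          Set.EqOn χ (φ t) (NWave.lowerHalfPlane M ∩ NWave.lowerHalfPlane M')) ∧
      -- its evolution
      ∀ t ∈ NWave.timeInterval a, ∀ z ∈ NWave.lowerHalfPlane M,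
        (∀ k : Fin m, 0 < (k : ℕ) →
          IsUnit (NWave.lowerBlock k (R t z * φ 0 z)) ∧
          ∀ (i : Fin m) (hi : i < k),
            φ t z i k =
              (NWave.psiBreve k (R t z * φ 0 z) *ᵥ Pi.single ⟨k, le_refl k⟩ 1) ⟨i, hi⟩) ∧
        ∀ i j : Fin m, (i = j → φ t z i j = 1) ∧ (j < i → φ t z i j = 0) := by
  open NWave in
  have h0 : (0 : ℝ) ∈ timeInterval a := ⟨le_rfl, by exact_mod_cast ha⟩
  have hM₀0 : 0 ≤ M₀ := (norm_nonneg _).trans (hM₀ 0 0 le_rfl h0)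
  have hgap : HasGaps d M₀ M := hasGaps_of_forall_lt hd hM₀0 hMpos hM
  have hcont : ∀ t ∈ timeInterval a, ContinuousOn (fun x => ⁅diagMat d, ϱ x t⁆) (Set.Ici 0) :=
    fun t ht => continuousOn_lie (hϱ_smooth.continuousOn.comp (f := fun y => (y, t))
      (by fun_prop) fun y hy => ⟨hy, ht⟩) _
  have hbd : ∀ t ∈ timeInterval a, ∀ x, 0 ≤ x → ‖⁅diagMat d, ϱ x t⁆‖ ≤ M₀ :=
    fun t ht x hx => hM₀ x t hx ht
  choose! φ hφ hφcone using fun t (ht : t ∈ timeInterval a) =>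
    exists_isWeylFunction hd.antitone hM₀0 hMpos.le hgap (hcont t ht) (hbd t ht)
  refine ⟨φ, fun t ht => ⟨hφ t ht, fun M' χ _ hχ =>
    IsWeylFunction.eqOn hMpos.le hgap (hcont t ht) (hbd t ht) (hφ t ht) hχ⟩,
    fun t ht z hz => ⟨fun k _ => ?_, (hφ t ht).2.2 z hz⟩⟩
  obtain ⟨C, hC⟩ := hϱ_bdd
  have hRz : IsFundamentalSolution dhat (fun t => ⁅diagMat dhat, ϱ 0 t⁆) (timeInterval a) z
      (fun t => R t z) :=
    ⟨(hR z).1, fun s hs => by beta_reduce; rw [hρhat s hs]; exact (hR z).2 s hs⟩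
  obtain ⟨w₀, hw₀⟩ := exists_isFundamentalSolution (d := d) (hcont 0 h0) z
  obtain ⟨w₁, hw₁⟩ := exists_isFundamentalSolution (d := d) (hcont t ht) z
  obtain ⟨B, hB⟩ := exists_bounded_factor ha hϱ_smooth hC hϱ hRz ht hw₀ hw₁
  obtain ⟨c, g, hg, hsep, hMg⟩ := hgap k
  have hzM : z.im < -M := hz
  have hz0 : z.im ≤ 0 := by linarith
  have hε : M₀ < -z.im * g := hMg.trans (mul_lt_mul_of_pos_right (by linarith) hg)
  refine psiBreve_mulVec_single hsep hz0 hε (hbd t ht) hw₁ (fun v hv => ?_) (fun j hj => ?_)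
    (hφcone t ht z hz)
  -- Injectivity of R(t,z)φ(0,z): R has a left inverse and φ(0,z) is triangular with unit diagonal.
  · have hsub := timeInterval_Icc_subset ht
    obtain ⟨X, hX⟩ := exists_mul_solution_eq_one (A := fun s =>
        (Complex.I * z) • diagMat dhat - ⁅diagMat dhat, ϱ 0 s⁆) (W := fun s => R s z) ht.1
      (continuousOn_const.sub (continuousOn_lie (hϱ_smooth.continuousOn.comp
        (f := fun s => ((0 : ℝ), s)) (by fun_prop) fun s hs => ⟨Set.mem_Ici.2 le_rfl, hsub hs⟩) _))
      hRz.1 fun s hs => (hRz.2 s (hsub hs)).mono hsub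
    have h := congrArg (fun u => X *ᵥ u) hv
    simp only [Matrix.mulVec_mulVec, Matrix.mulVec_zero, ← Matrix.mul_assoc, hX, Matrix.one_mul]
      at h
    exact eq_zero_of_mulVec_eq_zero_of_normalized (hφcone 0 h0 z hz).1 h
  · have h := ((hφcone 0 h0 z hz).isDecaying hsep hz0 hε (hbd 0 h0) hw₀ hj).transport hw₁ hB
    simpa only [toEuclideanCLM_colVec] using h
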